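/- For a finite simple undirected graph $G=(V,E)$ and integers $c\ge 1$, $k\ge 0$, call $(G,c,k)$ a yes-instance of Edge-Colorable Subgraph (ECS) if $E$ can be partitioned into $c$ (possibly empty) strong color classes $S^1,\dots,S^c$ and a set $W$ of weak edges with $|W|\le k$ such that no two distinct edges in the same strong color class share an endpoint. An edge-deletion set of $G$ and $t$ is a set $D\subseteq E$ such that $(V,E\setminus D)$ has maximum degree at most $t$; $\xi_t=\xi_t(G)$ denotes the minimum size of such a set. The core $\mathscr C(D)$ is the set of vertices incident with an edge of $D$, and $N(\mathscr C(D))$ is the set of vertices having a neighbor in $\mathscr C(D)$. Theorem. ECS admits a problem kernel with at most $4\,\xi_{c-1}\cdot c$ vertices and $\mathcal O(\xi_{c-1}\cdot c^2)$ edges that can be computed in $\mathcal O(n+m)$ time. Precisely, there is an algorithm (a random access machine with words of $\mathcal O(\log(n+m+c+k))$ bits and unit-cost instructions) which, given an instance $(G,c,k)$ with $c\ge1$, $n$ vertices and $m$ edges, encoded by $n,m,c,k$ and a list of the edges, computes in $\mathcal O(n+m+1)$ steps an instance $(G',c,k')$ such that $(G,c,k)$ is a yes-instance if and only if $(G',c,k')$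 is a yes-instance, $|V(G')|\le 4\,\xi_{c-1}(G)\cdot c$, $|E(G')|\in\mathcal O(\xi_{c-1}(G)\cdot c^2)$, and $k'=\min\{k,|E(G')|\}$. Moreover, $G'$ is isomorphic to $G[\mathscr C(D)\cup N(\mathscr C(D))]$ for some edge-deletion set $D$ of $G$ and $c-1$. The constants hidden in the $\mathcal O$-notation are absolute. -/

import Mathlib

/-! ## Edge-Colorable Subgraph -/

namespace ECS

/-- A `c`-colored labeling of `G`: a partition of the edge set into `c` (possibly empty) strong
color classes and one class of weak edges. The value `some i` means strong with color `i`, and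
`none` means weak. -/
abbrev Labeling {V : Type*} (G : SimpleGraph V) (c : ℕ) : Type _ :=
  G.EdgeLabeling (Option (Fin c))

/-- The set of weak edges of a labeling. -/
def Labeling.weak {V : Type*} {G : SimpleGraph V} {c : ℕ} (L : Labeling G c) : Set G.edgeSet :=
  {e | L e = none}

/-- A labeling is proper if no two distinct edges of the same strong color share an endpoint. -/
def Labeling.IsProper {V : Type*} {G : SimpleGraph V} {c : ℕ} (L : Labeling G c) : Prop :=
  ∀ (i : Fin c) (e f : G.edgeSet), e ≠ f → L e = some i → L f = some i →
    ∀ v : V, v ∈ (e : Sym2 V) → v ∉ (f : Sym2 V)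

/-- `(G, c, k)` is a yes-instance of Edge-Colorable Subgraph: there is a proper `c`-colored
labeling of `G` with at most `k` weak edges. -/
def IsYes {V : Type*} (G : SimpleGraph V) (c k : ℕ) : Prop :=
  ∃ L : Labeling G c, L.IsProper ∧ L.weak.encard ≤ k

/-- `D ⊆ E(G)` is an edge-deletion set of `G` and `t`: deleting the edges of `D` from `G` leaves a
graph in which every vertex has degree at most `t`. -/
def IsEdgeDeletionSet {V : Type*} (G : SimpleGraph V) (t : ℕ) (D : Finset (Sym2 V)) : Prop :=
  (D : Set (Sym2 V)) ⊆ G.edgeSet ∧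
    ∀ v : V, ((G.deleteEdges (D : Set (Sym2 V))).neighborSet v).encard ≤ t

/-- `ξ_t`: the minimum size of an edge-deletion set of the finite graph `G` and `t` (the set
of candidate sizes is never empty, since all edges may be deleted). -/
noncomputable def xi {V : Type*} [Finite V] (G : SimpleGraph V) (t : ℕ) : ℕ :=
  sInf {d | ∃ D : Finset (Sym2 V), IsEdgeDeletionSet G t D ∧ D.card = d}

/-- The core vertices of an edge set `D`: the vertices incident with at least one edge of `D`. -/
def core {V : Type*} (D : Finset (Sym2 V)) : Set V :=
  {v | ∃ e ∈ D, v ∈ e}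

/-- The neighborhood `N(S) = ⋃_{v ∈ S} N(v)` of a vertex set. -/
def nbhd {V : Type*} (G : SimpleGraph V) (S : Set V) : Set V :=
  ⋃ v ∈ S, G.neighborSet v

/-! ### Encoding of instances -/

/-- `l` lists the edges of `G`, every edge exactly once (in any order, and with its two
endpoints in any order). -/
def IsEdgeList {n : ℕ} (G : SimpleGraph (Fin n)) (l : List (Fin n × Fin n)) : Prop :=
  (l.map fun p => s(p.1, p.2)).Nodup ∧
    ∀ e : Sym2 (Fin n), e ∈ l.map (fun p => s(p.1, p.2)) ↔ e ∈ G.edgeSet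

/-- The instance `(G, c, k)`, where `G` has the vertices `0, …, n - 1` and the edge list `l`, as
a sequence of numbers: `n, |l|, c, k`, followed by the two endpoints of each edge. -/
def encode {n : ℕ} (l : List (Fin n × Fin n)) (c k : ℕ) : List ℕ :=
  n :: l.length :: c :: k :: l.flatMap fun p => [(p.1 : ℕ), (p.2 : ℕ)]

end ECS

/-! ## Random access machines

A word RAM with structured control flow. It has registers, of which a program can mention only
finitely many, a memory with indirect addressing, and an output tape. Every elementary
instruction and every test takes one step. Numbers greater than the bound `w` do not fit into a
machine word: an instruction that would create one cannot be executed. -/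

namespace RAM

/-- A machine state. -/
structure State where
  reg : ℕ → ℕ
  mem : ℕ → ℕ
  out : List ℕ

/-- The state with register `r` set to `a`. -/
def State.setReg (s : State) (r a : ℕ) : State :=
  { s with reg := Function.update s.reg r a }

/-- The elementary instructions. -/
inductive Instr where
  /-- `R[r] := a` -/
  | const (r a : ℕ)
  /-- `R[r] := R[i] + R[j]` -/
  | add (r i j : ℕ)
  /-- `R[r] := max (R[i] - R[j]) 0` -/
  | sub (r i j : ℕ)
  /-- `R[r] := M[R[i]]` -/
  | load (r i : ℕ)
  /-- `M[R[i]] := R[j]` -/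
  | store (i j : ℕ)
  /-- append `R[i]` to the output -/
  | write (i : ℕ)

/-- The effect of an elementary instruction; `none` if a number greater than `w` would arise. -/
def Instr.eval (w : ℕ) : Instr → State → Option State
  | .const r a, s => if a ≤ w then some (s.setReg r a) else none
  | .add r i j, s =>
      if s.reg i + s.reg j ≤ w then some (s.setReg r (s.reg i + s.reg j)) else none
  | .sub r i j, s => some (s.setReg r (s.reg i - s.reg j))
  | .load r i, s => some (s.setReg r (s.mem (s.reg i)))
  | .store i j, s => some { s with mem := Function.update s.mem (s.reg i) (s.reg j) }
  | .write i, s => some { s with out := s.out ++ [s.reg i] }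

/-- Programs. -/
inductive Prog where
  /-- do nothing -/
  | skip
  /-- an elementary instruction -/
  | instr (i : Instr)
  /-- first `p`, then `q` -/
  | seq (p q : Prog)
  /-- if `R[i] < R[j]` then `p` else `q` -/
  | ite (i j : ℕ) (p q : Prog)
  /-- while `R[i] < R[j]` do `p` -/
  | loop (i j : ℕ) (p : Prog)

/-- `Exec w p s t s'`: with word bound `w`, the program `p` started in state `s` halts after
exactly `t` steps in state `s'`. -/
inductive Exec (w : ℕ) : Prog → State → ℕ → State → Prop
  | skip (s : State) : Exec w .skip s 1 s
  | instr {i : Instr} {s s' : State} (h : i.eval w s = some s') : Exec w (.instr i) s 1 s'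
  | seq {p q : Prog} {s₁ s₂ s₃ : State} {a b : ℕ} (hp : Exec w p s₁ a s₂)
      (hq : Exec w q s₂ b s₃) : Exec w (.seq p q) s₁ (a + b) s₃
  | ite_true {i j : ℕ} {p q : Prog} {s s' : State} {a : ℕ} (h : s.reg i < s.reg j)
      (hp : Exec w p s a s') : Exec w (.ite i j p q) s (a + 1) s'
  | ite_false {i j : ℕ} {p q : Prog} {s s' : State} {a : ℕ} (h : ¬ s.reg i < s.reg j)
      (hq : Exec w q s a s') : Exec w (.ite i j p q) s (a + 1) s'
  | loop_stop {i j : ℕ} {p : Prog} {s : State} (h : ¬ s.reg i < s.reg j) :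
      Exec w (.loop i j p) s 1 s
  | loop_step {i j : ℕ} {p : Prog} {s₁ s₂ s₃ : State} {a b : ℕ} (h : s₁.reg i < s₁.reg j)
      (hp : Exec w p s₁ a s₂) (hl : Exec w (.loop i j p) s₂ b s₃) :
      Exec w (.loop i j p) s₁ (a + b + 1) s₃

/-- The initial state: the input stands at the beginning of the memory, the other memory cells
and all registers are zero, and the output is empty. -/
def init (input : List ℕ) : State where
  reg := fun _ => 0
  mem := fun i => input.getD i 0
  out := []

/-- With numbers bounded by `w`, the program `p` on the given input halts within `T` steps, having
written the given output. -/
def Computes (w T : ℕ) (p : Prog) (input output : List ℕ) : Prop :=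
  ∃ t ≤ T, ∃ s : State, Exec w p (init input) t s ∧ s.out = output

end RAM

/-! Scan the edges once and keep an edge exactly if both endpoints have fewer than `c - 1` kept
edges so far. The rejected edges form an edge-deletion set `D`, and each of them has an endpoint
that is saturated, with exactly `c - 1` kept edges. At a saturated vertex any edge-deletion set must
contain at least as many incident edges as `D` does. Summing over the saturated vertices counts each
edge of an optimal set at most twice, so `|D| ≤ 2ξ` (`card_sdiff_le_two_mul`). Hence there are at
most `4ξ` core vertices, each with at most `c - 1` neighbors along kept edges, which yields both
size bounds.

For the equivalence, consider a vertex outside the core and its neighborhood. Neither it nor any of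
its neighbors is a core vertex, so all of them have degree at most `c - 1` in `G`, and every proper
partial coloring misses a color at each of them. This is what Vizing's fan argument needs in order
to color one more edge at that vertex without uncoloring another (`exists_proper_insert`). A
coloring of the kernel therefore extends to `G` with no further weak edges
(`exists_coloring_extension`, `isYes_iff_of_embedding`); the converse is restriction. Capping the
budget at the number of kernel edges is harmless, as no more edges than that can be weak.

For the running time, four passes over the edges and one over the vertices suffice, with constant
work per item. The loop-free bodies are verified by weakest preconditions, the passes over the edges
by the invariant rule `run_forEdges`, and `computes_kernelize` assembles the phases. -/

/-! ## Extending partial proper edge colorings -/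

namespace EdgeColoring

open Relation

variable {V α : Type*}

/-- A partial coloring of the pairs of vertices is proper if pairs of the same color do not meet. -/
def Proper (C : Sym2 V → Option α) : Prop :=
  ∀ x y z i, C s(x, y) = some i → C s(x, z) = some i → y = z

/-- The color `i` is missing at the vertex `x`. -/
def Missing (C : Sym2 V → Option α) (x : V) (i : α) : Prop :=
  ∀ y, C s(x, y) ≠ some i

/-- The set of colored pairs. -/
def support (C : Sym2 V → Option α) : Set (Sym2 V) := {e | C e ≠ none}

open Classical in
/-- The vertex joined to `x` by a pair of color `i`, or `x` itself if there is none. -/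
noncomputable def partner (C : Sym2 V → Option α) (i : α) (x : V) : V :=
  if h : ∃ y, C s(x, y) = some i then h.choose else x

lemma partner_eq {C : Sym2 V → Option α} (hC : Proper C) {x y : V} {i : α}
    (h : C s(x, y) = some i) : partner C i x = y := by
  have h' : ∃ y, C s(x, y) = some i := ⟨y, h⟩
  rw [partner, dif_pos h']
  exact hC _ _ _ _ h'.choose_spec h

lemma partner_of_missing {C : Sym2 V → Option α} {x : V} {i : α} (h : Missing C x i) :
    partner C i x = x := by
  rw [partner, dif_neg]
  rintro ⟨y, hy⟩
  exact h y hy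

/-- Properness makes each color class a matching, which is read as an involution whose fixed points
include the vertices missing the color. Components of two colors become orbits of two involutions.
-/
lemma partner_involutive {C : Sym2 V → Option α} (hC : Proper C) (i : α) :
    Function.Involutive (partner C i) := by
  intro x
  by_cases h : ∃ y, C s(x, y) = some i
  · obtain ⟨y, hy⟩ := h
    rw [partner_eq hC hy]
    exact partner_eq hC (by rwa [Sym2.eq_swap])
  · have : Missing C x i := fun y hy => h ⟨y, hy⟩
    rw [partner_of_missing this, partner_of_missing this]

/-! ### Orbits of two involutions (Kempe chains) -/

/-- The orbit of a common dihedral action of two involutions, described from a fixed point of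
the first one, contains at most one further fixed point of either. -/
lemma fixed_eq_of_iterate {f g : V → V} (hf : f.Involutive) (hg : g.Involutive) {x : V}
    (hx : f x = x) {n m : ℕ} (hper : x ∈ Function.periodicPts (g ∘ f))
    (hn : f ((g ∘ f)^[n] x) = (g ∘ f)^[n] x ∨ g ((g ∘ f)^[n] x) = (g ∘ f)^[n] x)
    (hm : f ((g ∘ f)^[m] x) = (g ∘ f)^[m] x ∨ g ((g ∘ f)^[m] x) = (g ∘ f)^[m] x)
    (hnx : (g ∘ f)^[n] x ≠ x) (hmx : (g ∘ f)^[m] x ≠ x) :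
    (g ∘ f)^[n] x = (g ∘ f)^[m] x := by
  set σ := g ∘ f with hσ
  set N := Function.minimalPeriod σ x with hN
  have hN0 : 0 < N := Function.minimalPeriod_pos_of_mem_periodicPts hper
  have hfσ : ∀ y, σ (f (σ y)) = f y := by
    intro y; simp [hσ, hf _, hg _]
  -- The reflection `f` inverts the rotation `σ`: since `f x = x`, it sends `σ^k x` to `σ^(-k) x`.
  have hback : ∀ k, σ^[k] (f (σ^[k] x)) = x := by
    intro k
    induction k with
    | zero => simpa using hx
    | succ k ih => rw [Function.iterate_succ_apply, Function.iterate_succ_apply' σ k x, hfσ, ih]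
  have hgf : ∀ y, g y = σ (f y) := by intro y; simp [hσ, hf _]
  -- A point `σ^k x` fixed by `f` gives `σ^(2k) x = x`; one fixed by `g = σ ∘ f` gives `σ^(2k-1) x =
  -- x`.
  have key : ∀ k, (f (σ^[k] x) = σ^[k] x ∨ g (σ^[k] x) = σ^[k] x) →
      N ∣ 2 * k ∨ N ∣ 2 * k - 1 ∧ 0 < k := by
    intro k hk
    rcases hk with hk | hk
    · left
      apply Function.IsPeriodicPt.minimalPeriod_dvd
      have := hback k
      rw [hk, ← Function.iterate_add_apply] at this
      rw [two_mul]; exact this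
    · rcases Nat.eq_zero_or_pos k with rfl | hk0
      · left; simp
      right
      refine ⟨?_, hk0⟩
      apply Function.IsPeriodicPt.minimalPeriod_dvd
      have h1 := hback k
      rw [hgf] at hk
      obtain ⟨l, rfl⟩ : ∃ l, k = l + 1 := ⟨k - 1, by omega⟩
      rw [Function.iterate_succ_apply, hk, ← Function.iterate_add_apply] at h1
      have : 2 * (l + 1) - 1 = l + (l + 1) := by omega
      rw [this]; exact h1
  have hmod : ∀ k, σ^[k] x = σ^[k % N] x := fun k =>
    (Function.iterate_mod_minimalPeriod_eq).symm
  -- For `0 < k < N`, both `2k` and `2k - 1` lie strictly between `0` and `2N`, so the multiple of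
  -- `N` is `N` itself. The parity of `N` then determines `k`.
  have main : ∀ k, (f (σ^[k] x) = σ^[k] x ∨ g (σ^[k] x) = σ^[k] x) → σ^[k] x ≠ x →
      2 * (k % N) = N ∨ 2 * (k % N) = N + 1 := by
    intro k hk hkx
    rw [hmod] at hk hkx
    have hlt := Nat.mod_lt k hN0
    have h0 : k % N ≠ 0 := by
      intro h; rw [h] at hkx; exact hkx rfl
    rcases key _ hk with ⟨q, hq⟩ | ⟨⟨q, hq⟩, -⟩
    · rcases q with _ | _ | q
      · omega
      · left; omega
      · exfalso; nlinarith
    · rcases q with _ | _ | q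
      · omega
      · right; omega
      · exfalso
        have : N * (q + 1 + 1) ≥ 2 * N := by nlinarith
        omega
  have h1 := main n hn hnx
  have h2 := main m hm hmx
  rw [hmod n, hmod m, show n % N = m % N by omega]

/-- The component of `x` with respect to two involutions. -/
def component (f g : V → V) (x : V) : Set V :=
  {y | ReflTransGen (fun a b => b = f a ∨ b = g a) x y}

lemma mem_component_self (f g : V → V) (x : V) : x ∈ component f g x := ReflTransGen.refl

lemma component_left_mem {f g : V → V} {x y : V} (h : y ∈ component f g x) :
    f y ∈ component f g x := ReflTransGen.tail h (Or.inl rfl)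

lemma component_right_mem {f g : V → V} {x y : V} (h : y ∈ component f g x) :
    g y ∈ component f g x := ReflTransGen.tail h (Or.inr rfl)

/-- As `f` fixes `x`, it only reverses powers of `σ = g ∘ f` applied to `x`. By finiteness negative
powers are also positive ones, so the forward `σ`-orbit of `x` is closed under `f` and under `g = σ
∘ f`. -/
lemma exists_iterate_of_mem_component [Finite V] {f g : V → V} (hf : f.Involutive)
    (hg : g.Involutive) {x y : V} (hx : f x = x) (h : y ∈ component f g x) :
    x ∈ Function.periodicPts (g ∘ f) ∧ ∃ n, y = (g ∘ f)^[n] x := by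
  set σ := g ∘ f with hσ
  have hinj : Function.Injective σ := hg.injective.comp hf.injective
  have hper : ∀ z, z ∈ Function.periodicPts σ := fun z =>
    Function.Injective.mem_periodicPts hinj z
  refine ⟨hper x, ?_⟩
  have hfσ : ∀ y, σ (f (σ y)) = f y := by
    intro y; simp [hσ, hf _, hg _]
  have hback : ∀ k, σ^[k] (f (σ^[k] x)) = x := by
    intro k
    induction k with
    | zero => simpa using hx
    | succ k ih => rw [Function.iterate_succ_apply, Function.iterate_succ_apply' σ k x, hfσ, ih]
  have hfk : ∀ k, ∃ n, f (σ^[k] x) = σ^[n] x := by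
    intro k
    set z := f (σ^[k] x)
    have hz := Function.minimalPeriod_pos_of_mem_periodicPts (hper z)
    set N := Function.minimalPeriod σ z
    refine ⟨N * k - k, ?_⟩
    have h1 : σ^[N * k] z = z :=
      (Function.isPeriodicPt_minimalPeriod σ z).mul_const k
    have h2 : N * k = (N * k - k) + k := by
      have : k ≤ N * k := Nat.le_mul_of_pos_left _ hz
      omega
    rw [h2, Function.iterate_add_apply, hback] at h1
    exact h1.symm
  induction h with
  | refl => exact ⟨0, rfl⟩
  | tail _ h ih =>
    obtain ⟨n, rfl⟩ := ih
    obtain ⟨k, hk⟩ := hfk n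
    rcases h with rfl | rfl
    · exact ⟨k, hk⟩
    · refine ⟨k + 1, ?_⟩
      rw [Function.iterate_succ_apply', ← hk]
      simp [hσ, hf _]

lemma component_comm (f g : V → V) (x : V) : component f g x = component g f x := by
  unfold component; simp only [or_comm]

/-- Among three distinct vertices that are fixed by one of two involutions, the component of the
first does not contain both others. -/
lemma not_mem_component_of_fixed [Finite V] {f g : V → V} (hf : f.Involutive)
    (hg : g.Involutive) {x y z : V} (hx : f x = x ∨ g x = x) (hy : f y = y ∨ g y = y)
    (hz : f z = z ∨ g z = z) (hxy : y ≠ x) (hxz : z ≠ x) (hyz : y ≠ z) :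
    y ∉ component f g x ∨ z ∉ component f g x := by
  by_contra! h
  obtain ⟨h1, h2⟩ := h
  wlog hx' : f x = x generalizing f g
  · rw [component_comm] at h1 h2
    exact this hg hf hx.symm hy.symm hz.symm h1 h2 (hx.resolve_left hx')
  obtain ⟨hper, n, rfl⟩ := exists_iterate_of_mem_component hf hg hx' h1
  obtain ⟨-, m, rfl⟩ := exists_iterate_of_mem_component hf hg hx' h2
  exact hyz (fixed_eq_of_iterate hf hg hx' hper hy hz hxy hxz)

/-! ### Exchanging two colors on a component -/

/-- Exchange the colors `a` and `b` on the pairs that meet `X`. -/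
noncomputable def exchange [DecidableEq α] (C : Sym2 V → Option α) (a b : α) (X : Set V) :
    Sym2 V → Option α :=
  open Classical in fun e => if ∃ x ∈ e, x ∈ X then (C e).map (Equiv.swap a b) else C e

lemma support_exchange [DecidableEq α] (C : Sym2 V → Option α) (a b : α) (X : Set V) :
    support (exchange C a b X) = support C := by
  ext e
  simp only [support, exchange, Set.mem_ofPred_eq]
  split_ifs <;> simp

section Exchange

variable [DecidableEq α] {C : Sym2 V → Option α} {a b : α} {X : Set V}

/-- Because `X` is closed under pairs colored `a` or `b`, a pair leaving `X` has neither color and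
is unaffected by the swap. Testing a single endpoint is therefore enough. -/
lemma exchange_apply (hX : ∀ x y, x ∈ X → C s(x, y) = some a ∨ C s(x, y) = some b → y ∈ X)
    (x y : V) :
    exchange C a b X s(x, y) =
      open Classical in if x ∈ X then (C s(x, y)).map (Equiv.swap a b) else C s(x, y) := by
  unfold exchange
  by_cases hx : x ∈ X
  · rw [if_pos ⟨x, by simp, hx⟩, if_pos hx]
  · rw [if_neg hx]
    split_ifs with h
    · obtain ⟨z, hz, hzX⟩ := h
      have hzy : z = y := by
        rcases Sym2.mem_iff.1 hz with rfl | rfl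
        · exact absurd hzX hx
        · rfl
      subst hzy
      cases hC : C s(x, z) with
      | none => rfl
      | some i =>
        have h1 : i ≠ a := by
          rintro rfl
          exact hx (hX z x hzX (Or.inl (by rwa [Sym2.eq_swap])))
        have h2 : i ≠ b := by
          rintro rfl
          exact hx (hX z x hzX (Or.inr (by rwa [Sym2.eq_swap])))
        simp [Equiv.swap_apply_of_ne_of_ne h1 h2]
    · rfl

lemma proper_exchange
    (hX : ∀ x y, x ∈ X → C s(x, y) = some a ∨ C s(x, y) = some b → y ∈ X)
    (hC : Proper C) : Proper (exchange C a b X) := by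
  intro x y z i hy hz
  rw [exchange_apply hX] at hy hz
  split_ifs at hy hz
  · simp only [Option.map_eq_some_iff] at hy hz
    obtain ⟨j, hj, rfl⟩ := hy
    obtain ⟨j', hj', h⟩ := hz
    rw [(Equiv.swap a b).injective h] at hj'
    exact hC _ _ _ _ hj hj'
  · exact hC _ _ _ _ hy hz

lemma missing_exchange_of_notMem
    (hX : ∀ x y, x ∈ X → C s(x, y) = some a ∨ C s(x, y) = some b → y ∈ X)
    {x : V} (hx : x ∉ X) (i : α) :
    Missing (exchange C a b X) x i ↔ Missing C x i := by
  simp [Missing, exchange_apply hX, hx]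

lemma missing_exchange_of_mem
    (hX : ∀ x y, x ∈ X → C s(x, y) = some a ∨ C s(x, y) = some b → y ∈ X)
    {x : V} (hx : x ∈ X) (i : α) :
    Missing (exchange C a b X) x i ↔ Missing C x (Equiv.swap a b i) := by
  simp only [Missing, exchange_apply hX, hx, if_true]
  refine forall_congr' fun y => not_congr ?_
  rw [Option.map_eq_some_iff]
  constructor
  · rintro ⟨j, hj, rfl⟩; simpa using hj
  · intro h; exact ⟨_, h, by simp⟩

end Exchange

/-! ### Coloring one more pair -/

section Extend

variable {C : Sym2 V → Option α}

lemma proper_update_none [DecidableEq (Sym2 V)] (hC : Proper C) (e : Sym2 V) :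
    Proper (Function.update C e none) := by
  intro x y z i hy hz
  simp only [Function.update_apply] at hy hz
  split_ifs at hy hz
  exact hC _ _ _ _ hy hz

lemma proper_update_some [DecidableEq (Sym2 V)] (hC : Proper C) {x y : V} {i : α}
    (hx : Missing C x i) (hy : Missing C y i) :
    Proper (Function.update C s(x, y) (some i)) := by
  have aux : ∀ a b c j, s(a, b) = s(x, y) → C s(a, c) = some j → i ≠ j := by
    rintro a b c j h hj rfl
    have ha : a ∈ s(x, y) := by rw [← h]; simp
    rcases Sym2.mem_iff.1 ha with rfl | rfl
    · exact hx _ hj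
    · exact hy _ hj
  intro a b c j hb hc
  simp only [Function.update_apply] at hb hc
  split_ifs at hb hc with h1 h2 h2
  · exact Sym2.congr_right.1 (h1.trans h2.symm)
  · exact absurd (Option.some_injective _ hb) (aux _ _ _ _ h1 hc)
  · exact absurd (Option.some_injective _ hc) (aux _ _ _ _ h2 hb)
  · exact hC _ _ _ _ hb hc

/-- The fan relation at `u`: the pair `{u, z}` has a color that is missing at `x`. -/
def Fan (C : Sym2 V → Option α) (u x z : V) : Prop :=
  ∃ i, Missing C x i ∧ C s(u, z) = some i

/-- A walk inside `A` can be replaced by one that does not come back to its start. -/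
lemma exists_avoiding_start {R : V → V → Prop} {A : Set V} {x w : V}
    (h : ReflTransGen (fun a b => R a b ∧ b ∈ A) x w) :
    w = x ∨ ∃ y, R x y ∧ y ∈ A \ {x} ∧ w ∈ A \ {x} ∧
      ReflTransGen (fun a b => R a b ∧ b ∈ A \ {x}) y w := by
  induction h with
  | refl => exact Or.inl rfl
  | @tail b c _ hbc ih =>
    by_cases hc : c = x
    · exact Or.inl hc
    right
    rcases ih with rfl | ⟨y, hy, hyA, -, hyb⟩
    · exact ⟨c, hbc.1, ⟨hbc.2, hc⟩, ⟨hbc.2, hc⟩, .refl⟩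
    · exact ⟨y, hy, hyA, ⟨hbc.2, hc⟩, hyb.tail ⟨hbc.1, hbc.2, hc⟩⟩

/-- Rotating a fan: if a color is missing both at `u` and at a vertex that is reachable from `v`
in the fan at `u`, then the pair `{u, v}` can be colored. -/
lemma exists_of_rotate (u : V) (i : α) (A : Finset V) :
    ∀ (C : Sym2 V → Option α) (v w : V), Proper C → C s(u, v) = none →
      ReflTransGen (fun a b => Fan C u a b ∧ b ∈ (A : Set V)) v w → u ∉ A → v ∈ A →
      Missing C w i → Missing C u i →
      ∃ C' : Sym2 V → Option α, Proper C' ∧ support C' = insert s(u, v) (support C) := by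
  classical
  induction A using Finset.strongInduction with
  | H A ih =>
  intro C v w hC huv hvw huA hvA hw hu
  rcases exists_avoiding_start hvw with rfl | ⟨y, ⟨j, hj, hy⟩, hyA, hwA, hyw⟩
  · refine ⟨_, proper_update_some hC hu hw, ?_⟩
    ext e
    by_cases he : e = s(u, w)
    · subst he; simp [support]
    · simp [support, he]
  · have hyv : y ≠ v := fun h => hyA.2 h
    have hij : i ≠ j := by rintro rfl; exact hu y hy
    have hne : s(u, y) ≠ s(u, v) := fun h => hyv (Sym2.congr_right.1 h)
    -- Shift the color `j` of `{u, y}` to `{u, v}`, where it is missing at `v`. Now `{u, y}` is the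
    -- uncolored pair, and the rest of the walk avoids `v`, so `A` shrinks.
    set C₀ := Function.update C s(u, y) none with hC₀
    have hC₀u : Missing C₀ u j := by
      intro z hz
      rw [hC₀, Function.update_apply] at hz
      split_ifs at hz with h
      exact h (by rw [hC _ _ _ _ hz hy])
    have hC₀v : Missing C₀ v j := by
      intro z hz
      rw [hC₀, Function.update_apply] at hz
      split_ifs at hz with h
      exact hj _ hz
    set C₁ := Function.update C₀ s(u, v) (some j) with hC₁
    have hC₁p : Proper C₁ := proper_update_some (proper_update_none hC _) hC₀u hC₀v
    have hmiss : ∀ z k, z ≠ v → z ≠ u → Missing C z k → Missing C₁ z k := by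
      intro z k hzv hzu h t ht
      rw [hC₁, Function.update_apply] at ht
      split_ifs at ht with h1
      · have : z ∈ s(u, v) := by rw [← h1]; simp
        rcases Sym2.mem_iff.1 this with rfl | rfl <;> contradiction
      · rw [hC₀, Function.update_apply] at ht
        split_ifs at ht
        exact h _ ht
    have hwu : w ≠ u := by rintro rfl; exact huA hwA.1
    have hsub : (↑(A.erase v) : Set V) = ↑A \ {v} := by simp
    obtain ⟨C', hC', hs⟩ := ih (A.erase v) (Finset.erase_ssubset hvA) C₁ y w hC₁p
      (by rw [hC₁, Function.update_of_ne hne, hC₀, Function.update_self])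
      (by
        rw [hsub]
        have hyC : ∀ z, ReflTransGen (fun a b => Fan C u a b ∧ b ∈ (A : Set V) \ {v}) y z →
            z ∈ (A : Set V) \ {v} ∧
            ReflTransGen (fun a b => Fan C₁ u a b ∧ b ∈ (A : Set V) \ {v}) y z := by
          intro z hz
          induction hz with
          | refl => exact ⟨hyA, .refl⟩
          | @tail b c _ hbc ih =>
            refine ⟨hbc.2, ?_⟩
            -- The pair `{u, y}` has lost its color, so steps into `y` no longer exist; but then the
            -- walk can restart at `y`.
            by_cases hcy : c = y
            · rw [hcy]
            obtain ⟨⟨k, hk, hkc⟩, hcA⟩ := hbc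
            refine ih.2.tail ⟨⟨k, hmiss b k ih.1.2 ?_ hk, ?_⟩, hcA⟩
            · rintro rfl; exact huA ih.1.1
            · rw [hC₁, Function.update_of_ne, hC₀, Function.update_of_ne, hkc]
              · exact fun h => hcy (Sym2.congr_right.1 h)
              · exact fun h => hcA.2 (Sym2.congr_right.1 h)
        exact (hyC w hyw).2)
      (fun h => huA (Finset.mem_of_mem_erase h)) (by simpa [and_comm] using hyA)
      (hmiss w i hwA.2 hwu hw)
      (by
        intro z hz
        rw [hC₁, Function.update_apply] at hz
        split_ifs at hz with h1
        · exact hij (Option.some_injective _ hz).symm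
        · rw [hC₀, Function.update_apply] at hz
          split_ifs at hz
          exact hu _ hz)
    refine ⟨C', hC', ?_⟩
    rw [hs]
    ext e
    by_cases he : e = s(u, v)
    · subst he; simp [support, hC₁]
    · by_cases he' : e = s(u, y)
      · subst he'; simp [support, hy]
      · simp [support, hC₁, hC₀, he, he']

/-- **Vizing's fan argument**: an uncolored pair `{u, v}` can be colored if some color is missing
at `u`, at `v`, and at every vertex joined to `u` by a colored pair. -/
theorem exists_proper_insert [Finite V] (hC : Proper C) {u v : V} (huv : C s(u, v) = none)
    (hne : v ≠ u) (hu : ∃ i, Missing C u i) (hv : ∃ i, Missing C v i)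
    (hN : ∀ w, C s(u, w) ≠ none → ∃ i, Missing C w i) (hloop : C s(u, u) = none) :
    ∃ C' : Sym2 V → Option α, Proper C' ∧ support C' = insert s(u, v) (support C) := by
  classical
  have := Fintype.ofFinite V
  let A : Finset V := Finset.univ.erase u
  have restrict : ∀ (C : Sym2 V → Option α) (w : V), C s(u, u) = none →
      ReflTransGen (Fan C u) v w →
      ReflTransGen (fun a b => Fan C u a b ∧ b ∈ (A : Set V)) v w := by
    intro C w hl h
    refine ReflTransGen.mono ?_ _ _ h
    rintro a b ⟨i, hi, hb⟩
    refine ⟨⟨i, hi, hb⟩, ?_⟩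
    have : b ≠ u := by rintro rfl; simp [hl] at hb
    simp [A, this]
  -- If some vertex of the fan shares a missing color with `u`, rotation alone finishes.
  by_cases hcase : ∃ w i, ReflTransGen (Fan C u) v w ∧ Missing C w i ∧ Missing C u i
  · obtain ⟨w, i, hw, hwi, hui⟩ := hcase
    exact exists_of_rotate u i A C v w hC huv (restrict C w hloop hw) (by simp [A])
      (by simp [A, hne]) hwi hui
  push Not at hcase
  have hmiss : ∀ w, ReflTransGen (Fan C u) v w → ∃ i, Missing C w i := by
    intro w hw
    rcases ReflTransGen.cases_tail hw with rfl | ⟨b, -, i, -, hi⟩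
    · exact hv
    · exact hN w (by simp [hi])
  have hpres : ∀ w i, ReflTransGen (Fan C u) v w → Missing C w i →
      C s(u, partner C i u) = some i := by
    intro w i hw hi
    have := hcase w i hw hi
    simp only [Missing, not_forall, not_not] at this
    obtain ⟨y, hy⟩ := this
    rwa [partner_eq hC hy]
  -- Otherwise a missing color of a fan vertex leads from `u` to another fan vertex, which is never
  -- `v` because `{u, v}` is uncolored. This maps the fan into itself without `v`, so two fan
  -- vertices share a missing color.
  obtain ⟨w₁, w₂, d, hw₁, hw₂, hw, hd₁, hd₂⟩ : ∃ w₁ w₂ d, ReflTransGen (Fan C u) v w₁ ∧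
      ReflTransGen (Fan C u) v w₂ ∧ w₁ ≠ w₂ ∧ Missing C w₁ d ∧ Missing C w₂ d := by
    have : Nonempty α := hu.nonempty
    choose! f hf using hmiss
    let F : Finset V := {w | ReflTransGen (Fan C u) v w}
    have hvF : v ∈ F := by simp [F, ReflTransGen.refl]
    obtain ⟨x, hx, y, hy, hxy, h⟩ := Finset.exists_ne_map_eq_of_card_lt_of_maps_to
      (s := F) (t := F.erase v) (f := fun w => partner C (f w) u)
      (Finset.card_erase_lt_of_mem hvF) (by
        intro w hw
        have hw' : ReflTransGen (Fan C u) v w := by simpa [F] using hw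
        have := hpres w _ hw' (hf w hw')
        simp only [F, Finset.coe_erase, Set.mem_sdiff, Set.mem_singleton_iff, Finset.mem_coe,
          Finset.mem_filter, Finset.mem_univ, true_and]
        refine ⟨hw'.tail ⟨f w, hf w hw', this⟩, ?_⟩
        intro h
        rw [h, huv] at this
        simp at this)
    simp only [F, Finset.mem_filter, Finset.mem_univ, true_and] at hx hy
    have h1 := hpres x _ hx (hf x hx)
    have h2 := hpres y _ hy (hf y hy)
    rw [h, h2] at h1
    have h3 := Option.some_injective _ h1
    exact ⟨x, y, f x, hx, hy, hxy, hf x hx, h3 ▸ hf y hy⟩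
  obtain ⟨c, hc⟩ := hu
  have hw₁u : w₁ ≠ u := by rintro rfl; exact hcase _ _ hw₁ hd₁ hd₁
  have hw₂u : w₂ ≠ u := by rintro rfl; exact hcase _ _ hw₂ hd₂ hd₂
  have hcd : c ≠ d := by rintro rfl; exact hcase _ _ hw₁ hd₁ hc
  -- Exchanging `c` and `d` everywhere off the component of `u` leaves all colors at `u` unchanged.
  set X : Set V := (component (partner C c) (partner C d) u)ᶜ with hX
  have hXc : ∀ x y, x ∈ X → C s(x, y) = some c ∨ C s(x, y) = some d → y ∈ X := by
    intro x y hx hxy hy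
    refine hx ?_
    rcases hxy with hxy | hxy
    · rw [← partner_eq hC (show C s(y, x) = some c by rwa [Sym2.eq_swap])]
      exact component_left_mem hy
    · rw [← partner_eq hC (show C s(y, x) = some d by rwa [Sym2.eq_swap])]
      exact component_right_mem hy
  have huX : u ∉ X := fun h => h (mem_component_self _ _ _)
  -- All of `u`, `w₁`, `w₂` are fixed by one of the two involutions, so the component of `u` cannot
  -- contain both `w₁` and `w₂`.
  obtain ⟨w, hwr, hwX, hwd⟩ : ∃ w, ReflTransGen (Fan C u) v w ∧ w ∈ X ∧ Missing C w d := by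
    rcases not_mem_component_of_fixed (partner_involutive hC c) (partner_involutive hC d)
      (Or.inl (partner_of_missing hc)) (Or.inr (partner_of_missing hd₁))
      (Or.inr (partner_of_missing hd₂)) hw₁u hw₂u hw with h | h
    · exact ⟨w₁, hw₁, h, hd₁⟩
    · exact ⟨w₂, hw₂, h, hd₂⟩
  set C₁ := exchange C c d X with hC₁
  have huC : ∀ y, C₁ s(u, y) = C s(u, y) := fun y => by rw [hC₁, exchange_apply hXc, if_neg huX]
  have hmc : ∀ x ∈ X, Missing C x d → Missing C₁ x c := by
    intro x hx h
    rw [hC₁, missing_exchange_of_mem hXc hx, Equiv.swap_apply_left]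
    exact h
  -- A fan step is lost only if it uses `d` missing at a vertex of `X`; that vertex then misses `c`
  -- after the exchange and can serve as the target itself.
  have hreach : ∀ x, ReflTransGen (Fan C u) v x → ReflTransGen (Fan C₁ u) v x ∨
      ∃ y, ReflTransGen (Fan C₁ u) v y ∧ Missing C₁ y c := by
    intro x hx
    induction hx with
    | refl => exact Or.inl .refl
    | @tail b z _ hbz ih =>
      rcases ih with ih | ih
      swap
      · exact Or.inr ih
      obtain ⟨i, hi, hiz⟩ := hbz
      by_cases hbX : b ∈ X
      · by_cases hid : i = d
        · subst hid
          exact Or.inr ⟨b, ih, hmc b hbX hi⟩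
        · have hic : i ≠ c := by rintro rfl; exact hc _ hiz
          refine Or.inl (ih.tail ⟨i, ?_, by rw [huC, hiz]⟩)
          rwa [hC₁, missing_exchange_of_mem hXc hbX, Equiv.swap_apply_of_ne_of_ne hic hid]
      · refine Or.inl (ih.tail ⟨i, ?_, by rw [huC, hiz]⟩)
        rwa [hC₁, missing_exchange_of_notMem hXc hbX]
  obtain ⟨y, hy, hyc⟩ : ∃ y, ReflTransGen (Fan C₁ u) v y ∧ Missing C₁ y c := by
    rcases hreach w hwr with h | h
    · exact ⟨w, h, hmc w hwX hwd⟩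
    · exact h
  rw [← support_exchange C c d X]
  exact exists_of_rotate u c A C₁ v y (proper_exchange hXc hC) (by rw [huC, huv])
    (restrict C₁ y (by rw [huC, hloop]) hy) (by simp [A]) (by simp [A, hne]) hyc
    (by rwa [hC₁, missing_exchange_of_notMem hXc huX])

end Extend

end EdgeColoring

/-! ## The kernel -/

namespace ECS

open EdgeColoring

/-! ### Transferring colorings between a graph and an induced subgraph -/

section Extension

variable {V : Type*} {G : SimpleGraph V} {c : ℕ}

lemma exists_missing_of_encard_lt {C : Sym2 V → Option (Fin c)}
    (hs : support C ⊆ G.edgeSet) {w : V} (hw : (G.neighborSet w).encard < c) :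
    ∃ i, Missing C w i := by
  by_contra! h
  simp only [Missing, not_forall, not_not] at h
  choose f hf using h
  have hinj : Function.Injective f := by
    intro i j hij
    have h1 := hf i
    rw [hij, hf j] at h1
    exact (Option.some_injective _ h1).symm
  have hsub : Set.range f ⊆ G.neighborSet w := by
    rintro _ ⟨i, rfl⟩
    exact hs (show C s(w, f i) ≠ none by simp [hf i])
  have h1 := Set.encard_le_encard hsub
  rw [← Set.image_univ, hinj.encard_image, Set.encard_univ, ENat.card_eq_coe_fintype_card,
    Fintype.card_fin] at h1
  exact absurd hw (not_lt.2 h1)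

/-- A proper partial coloring can be extended to all edges with an endpoint outside `S`, if
outside `S` and next to it all degrees are smaller than the number of colors. -/
lemma exists_coloring_extension [Finite V] {S : Set V}
    (hdeg : ∀ u ∉ S, ∀ w, w = u ∨ G.Adj u w → (G.neighborSet w).encard < c)
    {C₀ : Sym2 V → Option (Fin c)} (hC₀ : Proper C₀) (hs : support C₀ ⊆ G.edgeSet) :
    ∃ C : Sym2 V → Option (Fin c), Proper C ∧ support C ⊆ G.edgeSet ∧
      support C₀ ⊆ support C ∧ ∀ e ∈ G.edgeSet, (∃ x ∈ e, x ∉ S) → e ∈ support C := by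
  suffices h : ∀ E : Set (Sym2 V), E.Finite → (∀ e ∈ E, e ∈ G.edgeSet ∧ ∃ x ∈ e, x ∉ S) →
      ∃ C : Sym2 V → Option (Fin c), Proper C ∧ support C ⊆ G.edgeSet ∧
        support C₀ ⊆ support C ∧ E ⊆ support C by
    obtain ⟨C, h1, h2, h3, h4⟩ := h {e | e ∈ G.edgeSet ∧ ∃ x ∈ e, x ∉ S} (Set.toFinite _)
      (fun e he => he)
    exact ⟨C, h1, h2, h3, fun e he hx => h4 ⟨he, hx⟩⟩
  intro E hE
  induction E, hE using Set.Finite.induction_on with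
  | empty => exact fun _ => ⟨C₀, hC₀, hs, subset_rfl, by simp⟩
  | @insert e E _ _ ih =>
    intro h
    obtain ⟨C, h1, h2, h3, h4⟩ := ih fun e he => h e (Set.mem_insert_of_mem _ he)
    obtain ⟨heG, u, hu, huS⟩ := h e (Set.mem_insert _ _)
    by_cases heC : e ∈ support C
    · exact ⟨C, h1, h2, h3, Set.insert_subset heC h4⟩
    obtain ⟨v, rfl⟩ := Sym2.mem_iff_exists.1 hu
    have huv : G.Adj u v := heG
    have key : ∀ w, w = u ∨ G.Adj u w → ∃ i, Missing C w i := fun w hw =>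
      exists_missing_of_encard_lt h2 (hdeg u huS w hw)
    -- The fan is taken at the endpoint outside `S`. Colors may change, but the set of colored edges
    -- only grows.
    obtain ⟨C', hC', hsupp⟩ := exists_proper_insert h1 (u := u) (v := v)
      (by simpa [support] using heC) huv.ne' (key u (Or.inl rfl)) (key v (Or.inr huv))
      (fun w hw => key w (Or.inr (h2 hw)))
      (by
        by_contra hl
        exact G.loopless.irrefl u (h2 hl))
    refine ⟨C', hC', ?_, ?_, ?_⟩
    · rw [hsupp]; exact Set.insert_subset heG h2
    · rw [hsupp]; exact h3.trans (Set.subset_insert _ _)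
    · rw [hsupp]; exact Set.insert_subset_insert h4

/-- Partial colorings of all pairs avoid subtypes of edges, so they can be recolored and moved along
embeddings directly; the weak edges are the uncolored ones. -/
lemma isYes_iff_exists_coloring {k : ℕ} :
    IsYes G c k ↔ ∃ C : Sym2 V → Option (Fin c), Proper C ∧ support C ⊆ G.edgeSet ∧
      (G.edgeSet \ support C).encard ≤ k := by
  classical
  constructor
  · rintro ⟨L, hL, hk⟩
    refine ⟨fun e => if h : e ∈ G.edgeSet then L ⟨e, h⟩ else none, ?_, ?_, ?_⟩
    · intro x y z i hy hz
      simp only at hy hz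
      split_ifs at hy hz with h1 h2
      by_contra hne
      refine hL i _ _ ?_ hy hz x (by simp) (by simp)
      intro h
      exact hne (Sym2.congr_right.1 (congrArg Subtype.val h))
    · intro e he
      by_contra h
      exact he (dif_neg h)
    · rw [← Subtype.val_injective.encard_image] at hk
      refine le_trans (Set.encard_le_encard ?_) hk
      rintro e ⟨he, hn⟩
      refine ⟨⟨e, he⟩, ?_, rfl⟩
      simpa [support, he, Labeling.weak] using hn
  · rintro ⟨C, hC, -, hk⟩
    refine ⟨fun e => C e, ?_, ?_⟩
    · rintro i ⟨e, he⟩ ⟨f, hf⟩ hne hei hfi v hve hvf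
      obtain ⟨y, rfl⟩ := Sym2.mem_iff_exists.1 hve
      obtain ⟨z, rfl⟩ := Sym2.mem_iff_exists.1 hvf
      exact hne (by simp [hC _ _ _ _ hei hfi])
    · rw [← Subtype.val_injective.encard_image]
      refine le_trans (Set.encard_le_encard ?_) hk
      rintro _ ⟨⟨e, he⟩, hn, rfl⟩
      exact ⟨he, fun h => h hn⟩

/-- Restricting an instance to an induced subgraph preserves the answer, if outside of the
subgraph and next to it all degrees are smaller than the number of colors. -/
theorem isYes_iff_of_embedding [Finite V] {V' : Type*} [Finite V'] {G' : SimpleGraph V'}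
    (f : G' ↪g G) (hdeg : ∀ u ∉ Set.range f, ∀ w, w = u ∨ G.Adj u w →
      (G.neighborSet w).encard < c) (k : ℕ) :
    IsYes G c k ↔ IsYes G' c (min k G'.edgeSet.ncard) := by
  rw [isYes_iff_exists_coloring, isYes_iff_exists_coloring]
  have hinj : Function.Injective (Sym2.map f) := Sym2.map.injective f.injective
  have hmem : ∀ e, Sym2.map f e ∈ G.edgeSet ↔ e ∈ G'.edgeSet := by
    intro e
    induction e with
    | _ x y => exact f.map_adj_iff
  constructor
  · rintro ⟨C, hC, hs, hk⟩
    refine ⟨fun e => C (e.map f), ?_, ?_, ?_⟩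
    · intro x y z i hy hz
      exact f.injective (hC _ _ _ _ hy hz)
    · intro e he
      exact (hmem e).1 (hs he)
    · rw [Monotone.map_min (f := ((↑) : ℕ → ℕ∞)) fun a b h => by exact_mod_cast h, le_min_iff,
        (Set.toFinite _).cast_ncard_eq]
      refine ⟨?_, Set.encard_le_encard Set.sdiff_subset⟩
      rw [← hinj.encard_image]
      refine le_trans (Set.encard_le_encard ?_) hk
      rintro _ ⟨e, ⟨he, hn⟩, rfl⟩
      exact ⟨(hmem e).2 he, hn⟩
  · rintro ⟨C', hC', hs', hk⟩
    have hval : ∀ e i, Function.extend (Sym2.map f) C' (fun _ => none) e = some i →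
        ∃ e', e'.map f = e ∧ C' e' = some i := by
      intro e i h
      by_cases he : ∃ e', Sym2.map f e' = e
      · obtain ⟨e', rfl⟩ := he
        rw [hinj.extend_apply] at h
        exact ⟨e', rfl, h⟩
      · rw [Function.extend_apply' _ _ _ he] at h
        cases h
    -- Transport the coloring of `G'` along `f`, leaving all other pairs uncolored, and extend it.
    -- An edge still uncolored has both endpoints in the range of `f` and comes from an uncolored
    -- edge of `G'`.
    obtain ⟨C, hC, hs, hsub, hall⟩ := exists_coloring_extension (c := c) hdeg
      (C₀ := Function.extend (Sym2.map f) C' (fun _ => none))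
      (by
        intro x y z i hy hz
        obtain ⟨e, he, hei⟩ := hval _ _ hy
        obtain ⟨g, hg, hgi⟩ := hval _ _ hz
        have hx : x ∈ Sym2.map f e := by rw [he]; simp
        obtain ⟨x', hx', rfl⟩ := Sym2.mem_map.1 hx
        have hx : f x' ∈ Sym2.map f g := by rw [hg]; simp
        obtain ⟨x'', hx'', hxx⟩ := Sym2.mem_map.1 hx
        rw [f.injective hxx] at hx''
        obtain ⟨y', rfl⟩ := Sym2.mem_iff_exists.1 hx'
        obtain ⟨z', rfl⟩ := Sym2.mem_iff_exists.1 hx''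
        have := hC' _ _ _ _ hei hgi
        rw [← Sym2.congr_right (a := f x'), ← he, ← hg, this])
      (by
        intro e he
        obtain ⟨i, hi⟩ := Option.ne_none_iff_exists'.1 he
        obtain ⟨e', rfl, hi'⟩ := hval _ _ hi
        exact (hmem e').2 (hs' (show C' e' ≠ none by simp [hi'])))
    refine ⟨C, hC, hs, ?_⟩
    refine le_trans ?_ (hk.trans (by exact_mod_cast min_le_left _ _))
    rw [← hinj.encard_image]
    refine Set.encard_le_encard ?_
    rintro e ⟨he, hn⟩
    have hin : ∀ x ∈ e, x ∈ Set.range f := by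
      by_contra! h
      exact hn (hall e he h)
    obtain ⟨e', rfl⟩ : ∃ e', Sym2.map f e' = e := by
      induction e with
      | _ x y =>
        obtain ⟨x', rfl⟩ := hin x (by simp)
        obtain ⟨y', rfl⟩ := hin y (by simp)
        exact ⟨s(x', y'), rfl⟩
    refine ⟨e', ⟨(hmem e').1 he, fun h => hn (hsub ?_)⟩, rfl⟩
    rw [support, Set.mem_ofPred_eq, hinj.extend_apply]
    exact h

end Extension

/-! ### Edge-deletion sets -/

lemma encard_neighborSet_eq {V : Type*} [DecidableEq V] (H : SimpleGraph V) (E : Finset (Sym2 V))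
    (hE : (E : Set (Sym2 V)) = H.edgeSet) (v : V) :
    (H.neighborSet v).encard = Finset.card {e ∈ E | v ∈ e} := by
  rw [← Set.encard_congr (H.incidenceSetEquivNeighborSet v), ← Set.encard_coe_eq_coe_finsetCard]
  congr 1
  ext e
  simp [SimpleGraph.incidenceSet, ← hE]

lemma encard_neighborSet_deleteEdges {V : Type*} [DecidableEq V] {G : SimpleGraph V}
    (E D : Finset (Sym2 V))
    (hE : (E : Set (Sym2 V)) = G.edgeSet) (v : V) :
    ((G.deleteEdges (D : Set (Sym2 V))).neighborSet v).encard = Finset.card {e ∈ E \ D | v ∈ e} :=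
  encard_neighborSet_eq _ _ (by rw [Finset.coe_sdiff, hE, SimpleGraph.edgeSet_deleteEdges]) v

lemma isEdgeDeletionSet_sdiff {V : Type*} [DecidableEq V] {G : SimpleGraph V}
    {E K : Finset (Sym2 V)} {t : ℕ}
    (hE : (E : Set (Sym2 V)) = G.edgeSet) (hK : K ⊆ E)
    (hdeg : ∀ v, Finset.card {e ∈ K | v ∈ e} ≤ t) : IsEdgeDeletionSet G t (E \ K) := by
  refine ⟨?_, fun v => ?_⟩
  · rw [← hE]
    exact_mod_cast Finset.sdiff_subset
  · rw [encard_neighborSet_deleteEdges E _ hE, Finset.sdiff_sdiff_eq_self hK]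
    exact_mod_cast hdeg v

/-- Such a `w` is not a core vertex, so no edge at `w` is deleted and its full degree is at most
`t`. -/
lemma encard_neighborSet_lt_of_notMem {V : Type*} {G : SimpleGraph V} {D : Finset (Sym2 V)}
    {t : ℕ} (hD : IsEdgeDeletionSet G t D) {u : V} (hu : u ∉ core D ∪ nbhd G (core D)) {w : V}
    (hw : w = u ∨ G.Adj u w) : (G.neighborSet w).encard < (t + 1 : ℕ) := by
  have hwD : w ∉ core D := by
    rintro h
    rcases hw with rfl | hw
    · exact hu (Or.inl h)
    · refine hu (Or.inr ?_)
      simp only [nbhd, Set.mem_iUnion, exists_prop]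
      exact ⟨w, h, hw.symm⟩
  have h : G.neighborSet w ⊆ (G.deleteEdges (D : Set (Sym2 V))).neighborSet w := by
    intro x hx
    rw [SimpleGraph.mem_neighborSet, SimpleGraph.deleteEdges_adj]
    exact ⟨hx, fun h => hwD ⟨_, h, by simp⟩⟩
  refine ((Set.encard_le_encard h).trans (hD.2 w)).trans_lt ?_
  exact_mod_cast Nat.lt_succ_self t

/-! ### Size bounds for the greedy edge-deletion set and the kernel -/

section Bounds

open Finset

variable {V : Type*} [Fintype V] [DecidableEq V] {G : SimpleGraph V}

lemma card_mem_sym2_le (e : Sym2 V) : #{v | v ∈ e} ≤ 2 := by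
  induction e with
  | _ x y =>
    refine le_trans (card_le_card ?_) (card_le_two (a := x) (b := y))
    intro v
    simp

lemma sum_card_incident_le (D : Finset (Sym2 V)) : ∑ v, #{e ∈ D | v ∈ e} ≤ 2 * #D := by
  have h := sum_card_bipartiteAbove_eq_sum_card_bipartiteBelow
    (s := (univ : Finset V)) (t := D) (fun v e => v ∈ e)
  simp only [bipartiteAbove, bipartiteBelow] at h
  rw [h, mul_comm]
  exact sum_le_card_nsmul _ _ _ fun e _ => card_mem_sym2_le e

/-- If `K` is a maximal set of edges that induces degrees at most `t`, then its complement has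
at most twice as many edges as any edge-deletion set. -/
lemma card_sdiff_le_two_mul {E K D : Finset (Sym2 V)} {t : ℕ}
    (hE : (E : Set (Sym2 V)) = G.edgeSet) (hK : K ⊆ E)
    (hmax : ∀ e ∈ E, e ∉ K → ∃ v ∈ e, #{e ∈ K | v ∈ e} = t) (hD : IsEdgeDeletionSet G t D) :
    #(E \ K) ≤ 2 * #D := by
  have hDE : D ⊆ E := by
    have := hD.1
    rw [← hE] at this
    exact_mod_cast this
  let F : Finset V := {v | #{e ∈ K | v ∈ e} = t}
  calc #(E \ K) ≤ #(F.biUnion fun v => {e ∈ E \ K | v ∈ e}) := by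
        refine card_le_card fun e he => ?_
        obtain ⟨h1, h2⟩ := mem_sdiff.1 he
        obtain ⟨v, hv, hvt⟩ := hmax e h1 h2
        simp only [mem_biUnion, mem_filter, F, mem_univ, true_and]
        exact ⟨v, hvt, he, hv⟩
    _ ≤ ∑ v ∈ F, #{e ∈ E \ K | v ∈ e} := card_biUnion_le
    -- At a vertex with exactly `t` edges in `K`, the complement of `K` has `deg v - t` edges, and
    -- `D` needs at least that many.
    _ ≤ ∑ v ∈ F, #{e ∈ D | v ∈ e} := by
        refine sum_le_sum fun v hv => ?_
        have h1 : #{e ∈ K | v ∈ e} = t := by simpa [F] using hv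
        have h2 : #{e ∈ E \ D | v ∈ e} ≤ t := by
          have := hD.2 v
          rw [encard_neighborSet_deleteEdges E D hE] at this
          exact_mod_cast this
        have h3 : ∀ A ⊆ E, #{e ∈ E \ A | v ∈ e} + #{e ∈ A | v ∈ e} = #{e ∈ E | v ∈ e} := by
          intro A hA
          rw [← card_union_of_disjoint (disjoint_filter_filter sdiff_disjoint), ← filter_union,
            sdiff_union_of_subset hA]
        have h4 := h3 K hK
        have h5 := h3 D hDE
        omega
    _ ≤ ∑ v, #{e ∈ D | v ∈ e} := sum_le_sum_of_subset (subset_univ _)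
    _ ≤ 2 * #D := sum_card_incident_le D

lemma card_sdiff_le_two_mul_xi {E K : Finset (Sym2 V)} {t : ℕ}
    (hE : (E : Set (Sym2 V)) = G.edgeSet) (hK : K ⊆ E)
    (hdeg : ∀ v, #{e ∈ K | v ∈ e} ≤ t)
    (hmax : ∀ e ∈ E, e ∉ K → ∃ v ∈ e, #{e ∈ K | v ∈ e} = t) :
    #(E \ K) ≤ 2 * xi G t := by
  obtain ⟨D, hD, hcard⟩ := Nat.sInf_mem
    (s := {d | ∃ D : Finset (Sym2 V), IsEdgeDeletionSet G t D ∧ D.card = d})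
    ⟨_, _, isEdgeDeletionSet_sdiff hE hK hdeg, rfl⟩
  rw [xi, ← hcard]
  exact card_sdiff_le_two_mul hE hK hmax hD

lemma ncard_core_le (D : Finset (Sym2 V)) : (core D).ncard ≤ 2 * #D := by
  have h : core D = ((D.biUnion fun e => {v | v ∈ e} : Finset V) : Set V) := by
    ext v; simp [core]
  rw [h, Set.ncard_coe_finset, mul_comm]
  exact card_biUnion_le_card_mul _ _ _ fun e _ => card_mem_sym2_le e

/-- Neighbors along deleted edges are core vertices themselves, so each of the at most `2 * #D` core
vertices accounts for itself and at most `t` others. -/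
lemma ncard_core_union_nbhd_le {D : Finset (Sym2 V)} {t : ℕ} (hD : IsEdgeDeletionSet G t D) :
    (core D ∪ nbhd G (core D)).ncard ≤ 2 * #D * (t + 1) := by
  classical
  let X : Finset V := (core D).toFinset
  have hX : #X ≤ 2 * #D := by
    rw [← Set.ncard_eq_toFinset_card']
    exact ncard_core_le D
  let N : V → Finset V := fun v => ((G.deleteEdges (D : Set (Sym2 V))).neighborSet v).toFinset
  have hN : ∀ v, #(N v) ≤ t := by
    intro v
    have := hD.2 v
    rw [Set.encard_eq_coe_toFinset_card] at this
    exact_mod_cast this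
  have hsub : core D ∪ nbhd G (core D) ⊆
      ((X.biUnion fun v => insert v (N v) : Finset V) : Set V) := by
    intro w hw
    simp only [coe_biUnion, Set.mem_iUnion, mem_coe, exists_prop, mem_insert, X, N,
      Set.mem_toFinset]
    rcases hw with hw | hw
    · exact ⟨w, hw, Or.inl rfl⟩
    · simp only [nbhd, Set.mem_iUnion, exists_prop] at hw
      obtain ⟨v, hv, hvw⟩ := hw
      by_cases hD : s(v, w) ∈ D
      · exact ⟨w, ⟨_, hD, by simp⟩, Or.inl rfl⟩
      · refine ⟨v, hv, Or.inr ?_⟩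
        rw [SimpleGraph.mem_neighborSet, SimpleGraph.deleteEdges_adj]
        exact ⟨hvw, hD⟩
  refine (Set.ncard_le_ncard hsub).trans ?_
  rw [Set.ncard_coe_finset]
  refine (card_biUnion_le_card_mul _ _ (t + 1) fun v _ => ?_).trans (Nat.mul_le_mul_right _ hX)
  exact (card_insert_le _ _).trans (Nat.succ_le_succ (hN v))

/-- Edges outside `D` are charged to an endpoint, which has at most `t` of them. -/
lemma ncard_edgeSet_le_of_embedding {V' : Type*} [Fintype V'] {G' : SimpleGraph V'}
    (f : G' ↪g G) {D : Finset (Sym2 V)} {t : ℕ} (hD : IsEdgeDeletionSet G t D) :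
    G'.edgeSet.ncard ≤ #D + Fintype.card V' * t := by
  classical
  have hinj : Function.Injective (Sym2.map f) := Sym2.map.injective f.injective
  let N : V → Finset V := fun v => ((G.deleteEdges (D : Set (Sym2 V))).neighborSet v).toFinset
  have hN : ∀ v, #(N v) ≤ t := by
    intro v
    have := hD.2 v
    rw [Set.encard_eq_coe_toFinset_card] at this
    exact_mod_cast this
  have hsub : Sym2.map f '' G'.edgeSet ⊆
      ((D ∪ (univ : Finset V').biUnion fun x => (N (f x)).image fun w => s(f x, w) :
        Finset (Sym2 V)) : Set (Sym2 V)) := by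
    rintro _ ⟨e, he, rfl⟩
    induction e with
    | _ x y =>
      by_cases h : s(f x, f y) ∈ D
      · simp [h]
      · simp only [coe_union, Set.mem_union, mem_coe, mem_biUnion, mem_univ, true_and, mem_image]
        refine Or.inr ⟨x, f y, ?_, rfl⟩
        simp only [N, Set.mem_toFinset, SimpleGraph.mem_neighborSet, SimpleGraph.deleteEdges_adj]
        exact ⟨f.map_adj_iff.2 he, h⟩
  rw [← Set.ncard_image_of_injective _ hinj]
  refine (Set.ncard_le_ncard hsub).trans ?_
  rw [Set.ncard_coe_finset]
  refine (card_union_le _ _).trans (Nat.add_le_add_left ?_ _)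
  rw [← Finset.card_univ]
  exact card_biUnion_le_card_mul _ _ _ fun x _ => card_image_le.trans (hN _)

end Bounds

end ECS

/-! ## Verifying random access machine programs -/

namespace RAM

/-- The program `p` started in `s` halts within `T` steps in a state that satisfies `Q`. -/
def Run (w : ℕ) (p : Prog) (T : ℕ) (Q : State → Prop) (s : State) : Prop :=
  ∃ t ≤ T, ∃ s', Exec w p s t s' ∧ Q s'

lemma Run.seq {w : ℕ} {p q : Prog} {T₁ T₂ : ℕ} {Q R : State → Prop} {s : State}
    (hp : Run w p T₁ R s) (hq : ∀ s', R s' → Run w q T₂ Q s') :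
    Run w (.seq p q) (T₁ + T₂) Q s := by
  obtain ⟨t, ht, s', h, hR⟩ := hp
  obtain ⟨t', ht', s'', h', hQ⟩ := hq s' hR
  exact ⟨t + t', by omega, s'', .seq h h', hQ⟩

lemma Run.mono {w : ℕ} {p : Prog} {T T' : ℕ} {Q R : State → Prop} {s : State}
    (h : Run w p T R s) (hT : T ≤ T') (hQ : ∀ s', R s' → Q s') : Run w p T' Q s := by
  obtain ⟨t, ht, s', h, hR⟩ := h
  exact ⟨t, ht.trans hT, s', h, hQ s' hR⟩

/-- The invariant is indexed by the iteration number, so it also fixes the number `N` of iterations.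
Each costs one test besides its body, and the last test adds one step. -/
lemma Run.loop {w i j : ℕ} {p : Prog} {T N : ℕ} (I : ℕ → State → Prop)
    (hstep : ∀ k < N, ∀ s, I k s → s.reg i < s.reg j ∧ Run w p T (I (k + 1)) s)
    (hdone : ∀ s, I N s → ¬ s.reg i < s.reg j) {s : State} (h : I 0 s) :
    Run w (.loop i j p) (N * (T + 1) + 1) (I N) s := by
  suffices H : ∀ d k, k + d = N → ∀ s, I k s →
      Run w (.loop i j p) (d * (T + 1) + 1) (I N) s from H N 0 (by omega) s h
  intro d
  induction d with
  | zero =>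
    rintro k rfl s hs
    exact ⟨1, by omega, s, by constructor; exact hdone s hs, hs⟩
  | succ d ih =>
    intro k hk s hs
    obtain ⟨hlt, t, ht, s', hex, hI⟩ := hstep k (by omega) s hs
    obtain ⟨t', ht', s'', hex', hI'⟩ := ih (k + 1) (by omega) s' hI
    refine ⟨t + t' + 1, ?_, s'', .loop_step hlt hex hex', hI'⟩
    rw [Nat.succ_mul]; omega

/-- The state with memory cell `a` set to `x`. -/
def State.setMem (s : State) (a x : ℕ) : State :=
  { s with mem := Function.update s.mem a x }

/-- The state with `x` appended to the output. -/
def State.emit (s : State) (x : ℕ) : State :=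
  { s with out := s.out ++ [x] }

section StateLemmas

variable (s : State) (r a x : ℕ)

@[simp] lemma reg_setReg (q : ℕ) : (s.setReg r a).reg q = if q = r then a else s.reg q := by
  simp [State.setReg, Function.update_apply]
@[simp] lemma mem_setReg : (s.setReg r a).mem = s.mem := rfl
@[simp] lemma out_setReg : (s.setReg r a).out = s.out := rfl
@[simp] lemma reg_setMem : (s.setMem a x).reg = s.reg := rfl
@[simp] lemma mem_setMem (b : ℕ) : (s.setMem a x).mem b = if b = a then x else s.mem b := by
  simp [State.setMem, Function.update_apply]
@[simp] lemma out_setMem : (s.setMem a x).out = s.out := rfl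
@[simp] lemma reg_emit : (s.emit x).reg = s.reg := rfl
@[simp] lemma mem_emit : (s.emit x).mem = s.mem := rfl
@[simp] lemma out_emit : (s.emit x).out = s.out ++ [x] := rfl

end StateLemmas

/-! ### Weakest preconditions for loop-free programs -/

/-- The weakest precondition of an elementary instruction. -/
def Instr.wp (w : ℕ) : Instr → (State → Prop) → State → Prop
  | .const r a, Q, s => a ≤ w ∧ Q (s.setReg r a)
  | .add r i j, Q, s => s.reg i + s.reg j ≤ w ∧ Q (s.setReg r (s.reg i + s.reg j))
  | .sub r i j, Q, s => Q (s.setReg r (s.reg i - s.reg j))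
  | .load r i, Q, s => Q (s.setReg r (s.mem (s.reg i)))
  | .store i j, Q, s => Q (s.setMem (s.reg i) (s.reg j))
  | .write i, Q, s => Q (s.emit (s.reg i))

/-- The weakest precondition of a program without loops. -/
def Prog.wp (w : ℕ) : Prog → (State → Prop) → State → Prop
  | .skip, Q, s => Q s
  | .instr i, Q, s => i.wp w Q s
  | .seq p q, Q, s => p.wp w (q.wp w Q) s
  | .ite i j p q, Q, s =>
      (s.reg i < s.reg j → p.wp w Q s) ∧ (¬ s.reg i < s.reg j → q.wp w Q s)
  | .loop _ _ _, _, _ => False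

/-- A bound on the number of steps of a program without loops. -/
def Prog.cost : Prog → ℕ
  | .skip => 1
  | .instr _ => 1
  | .seq p q => p.cost + q.cost
  | .ite _ _ p q => p.cost + q.cost + 1
  | .loop _ _ p => p.cost

lemma Instr.eval_of_wp {w : ℕ} {i : Instr} {Q : State → Prop} {s : State} (h : i.wp w Q s) :
    ∃ s', i.eval w s = some s' ∧ Q s' := by
  cases i with
  | const r a => exact ⟨_, if_pos h.1, h.2⟩
  | add r i j => exact ⟨_, if_pos h.1, h.2⟩
  | sub r i j => exact ⟨_, rfl, h⟩
  | load r i => exact ⟨_, rfl, h⟩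
  | store i j => exact ⟨_, rfl, h⟩
  | write i => exact ⟨_, rfl, h⟩

lemma run_of_wp {w : ℕ} {p : Prog} {Q : State → Prop} {s : State} (h : p.wp w Q s) :
    Run w p p.cost Q s := by
  induction p generalizing Q s with
  | skip => exact ⟨1, le_rfl, s, .skip s, h⟩
  | instr i =>
    obtain ⟨s', hs', hQ⟩ := Instr.eval_of_wp h
    exact ⟨1, le_rfl, s', .instr hs', hQ⟩
  | seq p q ihp ihq => exact (ihp h).seq fun s' hs' => ihq hs'
  | ite i j p q ihp ihq =>
    by_cases hlt : s.reg i < s.reg j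
    · obtain ⟨t, ht, s', hex, hQ⟩ := ihp (h.1 hlt)
      exact ⟨t + 1, by simp only [Prog.cost]; omega, s', .ite_true hlt hex, hQ⟩
    · obtain ⟨t, ht, s', hex, hQ⟩ := ihq (h.2 hlt)
      exact ⟨t + 1, by simp only [Prog.cost]; omega, s', .ite_false hlt hex, hQ⟩
  | loop => exact h.elim

/-- A block of elementary instructions. -/
def block : List Instr → Prog
  | [] => .skip
  | i :: l => .seq (.instr i) (block l)

@[simp] lemma wp_block_nil (w : ℕ) (Q : State → Prop) (s : State) :
    (block []).wp w Q s ↔ Q s := Iff.rfl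

@[simp] lemma wp_block_cons (w : ℕ) (i : Instr) (l : List Instr) (Q : State → Prop) (s : State) :
    (block (i :: l)).wp w Q s ↔ i.wp w ((block l).wp w Q) s := Iff.rfl

/-! ### Memory layout and iteration over the edge list -/

/-- The first address of the array number `i`, where all arrays have length `n` and stand behind
the input with `m` edges. -/
def arr (n m i : ℕ) : ℕ := 4 + 2 * m + i * n

/-- The part of the state that is fixed after the initialization: the constants in the registers
and the input in the memory. -/
structure Ready {n : ℕ} (edges : List (Fin n × Fin n)) (c k : ℕ) (s : State) : Prop where
  zero : s.reg 0 = 0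
  one : s.reg 1 = 1
  order : s.reg 2 = n
  t : s.reg 4 = c - 1
  cnt : s.reg 7 = arr n edges.length 0
  core : s.reg 8 = arr n edges.length 1
  mark : s.reg 9 = arr n edges.length 2
  id : s.reg 10 = arr n edges.length 3
  c : s.mem 2 = c
  k : s.mem 3 = k
  fst : ∀ i (h : i < edges.length), s.mem (4 + 2 * i) = edges[i].1
  snd : ∀ i (h : i < edges.length), s.mem (5 + 2 * i) = edges[i].2

lemma Ready.congr {n : ℕ} {edges : List (Fin n × Fin n)} {c k : ℕ} {s s' : State}
    (h : Ready edges c k s) (hreg : ∀ r ≤ 10, r ≠ 6 → s'.reg r = s.reg r)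
    (hmem : ∀ a < 4 + 2 * edges.length, s'.mem a = s.mem a) : Ready edges c k s' where
  zero := by rw [hreg 0 (by omega) (by omega), h.zero]
  one := by rw [hreg 1 (by omega) (by omega), h.one]
  order := by rw [hreg 2 (by omega) (by omega), h.order]
  t := by rw [hreg 4 (by omega) (by omega), h.t]
  cnt := by rw [hreg 7 (by omega) (by omega), h.cnt]
  core := by rw [hreg 8 (by omega) (by omega), h.core]
  mark := by rw [hreg 9 (by omega) (by omega), h.mark]
  id := by rw [hreg 10 (by omega) (by omega), h.id]
  c := by rw [hmem 2 (by omega), h.c]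
  k := by rw [hmem 3 (by omega), h.k]
  fst i hi := by rw [hmem _ (by omega), h.fst i hi]
  snd i hi := by rw [hmem _ (by omega), h.snd i hi]

/-- Execute `body` for every edge, with the endpoints in the registers 11 and 12. -/
def forEdges (body : Prog) : Prog :=
  .seq (block [.const 6 4]) (.loop 6 7
    (.seq (block [.load 11 6, .add 6 6 1, .load 12 6, .add 6 6 1]) body))

/-- The loop invariant rule for `forEdges`, where the invariant `I` refers to the list of the
edges that are already processed. -/
lemma run_forEdges {n : ℕ} {edges : List (Fin n × Fin n)} {c k w : ℕ}
    (hw : 4 + 2 * edges.length ≤ w) {body : Prog}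
    (I : List (Fin n × Fin n) → State → Prop)
    (hI : ∀ l s s', I l s → s'.mem = s.mem → s'.out = s.out →
      (∀ r ≥ 13, s'.reg r = s.reg r) → I l s')
    (hbody : ∀ l p, l ++ [p] <+: edges → ∀ s, Ready edges c k s → I l s → s.reg 11 = p.1 →
      s.reg 12 = p.2 →
      body.wp w (fun s' => Ready edges c k s' ∧ s'.reg 6 = s.reg 6 ∧ I (l ++ [p]) s') s)
    {s : State} (hs : Ready edges c k s) (h : I [] s) :
    Run w (forEdges body) (edges.length * (body.cost + 6) + 3)
      (fun s' => Ready edges c k s' ∧ I edges s') s := by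
  have hpre : Run w (block [.const 6 4]) 2
      (fun s' => Ready edges c k s' ∧ s'.reg 6 = 4 + 2 * 0 ∧ I (edges.take 0) s') s := by
    refine run_of_wp (p := block [.const 6 4]) ?_
    simp only [wp_block_cons, wp_block_nil, Instr.wp]
    refine ⟨by omega, hs.congr ?_ ?_, by simp, hI _ s _ h rfl rfl ?_⟩
    · intro r _ hr; simp [hr]
    · intro a _; rfl
    · intro r hr; simp [show r ≠ 6 by omega]
  -- The 5 counts the four loading instructions and the `skip` that ends the block; the further 1 is
  -- the loop test.
  refine Run.mono (hpre.seq (T₂ := edges.length * (5 + body.cost + 1) + 1) fun s' hs' =>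
    Run.loop (fun i s => Ready edges c k s ∧ s.reg 6 = 4 + 2 * i ∧ I (edges.take i) s)
      (N := edges.length) ?_ ?_ hs') ?_ ?_
  · rintro i hi s ⟨hR, h6, hIs⟩
    -- Register 7, the base of array 0, is also the first address behind the edge list and so bounds
    -- the loop.
    refine ⟨by rw [h6, hR.cnt, arr]; omega, ?_⟩
    refine (run_of_wp (p := .seq _ body) ?_ : Run w _ (Prog.cost (.seq _ body)) _ _)
    simp only [Prog.wp, wp_block_cons, wp_block_nil, Instr.wp]
    have h1 := hR.one
    simp only [reg_setReg, mem_setReg]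
    norm_num
    simp only [h6, h1]
    refine ⟨by omega, by omega, ?_⟩
    have htake : edges.take (i + 1) = edges.take i ++ [edges[i]] := by
      rw [List.take_add_one, List.getElem?_eq_getElem hi]; rfl
    set s' := (((s.setReg 11 (s.mem (4 + 2 * i))).setReg 6 (4 + 2 * i + 1)).setReg 12
      (s.mem (4 + 2 * i + 1))).setReg 6 (4 + 2 * i + 1 + 1) with hs'
    have := hbody (edges.take i) edges[i] (by rw [← htake]; exact List.take_prefix _ _) s'
      (hR.congr (by intro r hr h6; simp [hs', h6, show r ≠ 11 by omega, show r ≠ 12 by omega])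
        (by intro a _; rfl))
      (hI _ s _ hIs rfl rfl (by
        intro r hr
        simp [hs', show r ≠ 11 by omega, show r ≠ 12 by omega, show r ≠ 6 by omega]))
      (by simp [hs', hR.fst i hi])
      (by simp [hs', show 4 + 2 * i + 1 = 5 + 2 * i by omega, hR.snd i hi])
    rw [htake]
    have h6' : s'.reg 6 = 4 + 2 * (i + 1) := by simp [hs']; omega
    rw [h6'] at this
    exact this
  · rintro s ⟨hR, h6, -⟩
    rw [h6, hR.cnt, arr]; omega
  · have : edges.length * (5 + body.cost + 1) = edges.length * (body.cost + 6) := by ring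
    omega
  · rintro s' ⟨hR, -, h⟩
    rw [List.take_length] at h
    exact ⟨hR, h⟩

end RAM

/-! ## The kernelization program -/

namespace RAM

open Finset

/-- The array number `i` holds the values of `f`. -/
def Holds (n m i : ℕ) (f : Fin n → ℕ) (s : State) : Prop :=
  ∀ v : Fin n, s.mem (arr n m i + v) = f v

lemma arr_add_eq_iff {n m i j : ℕ} {u v : Fin n} :
    arr n m i + u = arr n m j + v ↔ i = j ∧ u = v := by
  constructor
  · intro h
    have h' : (u : ℕ) + n * i = v + n * j := by
      rw [arr, arr] at h
      rw [mul_comm n i, mul_comm n j]; omega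
    have hn : 0 < n := u.pos
    have h1 := congrArg (· / n) h'
    simp only [Nat.add_mul_div_left _ _ hn, Nat.div_eq_of_lt u.2, Nat.div_eq_of_lt v.2,
      zero_add] at h1
    subst h1
    exact ⟨rfl, Fin.ext (by omega)⟩
  · rintro ⟨rfl, rfl⟩; rfl

lemma le_arr_add (n m i a : ℕ) : 4 + 2 * m ≤ arr n m i + a := by
  rw [arr]; omega

lemma arr_add_le {n m i : ℕ} (hi : i ≤ 3) (v : Fin n) : arr n m i + v ≤ 4 + 2 * m + 4 * n := by
  have := Nat.mul_le_mul_right n hi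
  have := v.2
  rw [arr]; omega

section Programs

/-- Load the entries for the two endpoints of the current edge of the array whose address is in
the register `b` into the registers 15 and 16. -/
def fetch (b : ℕ) : Prog :=
  block [.add 13 b 11, .add 14 b 12, .load 15 13, .load 16 14]

/-- Write 1 into the entries for the two endpoints of the current edge of the array whose address
is in the register `b`. -/
def setOnes (b : ℕ) : Prog :=
  block [.add 13 b 11, .add 14 b 12, .store 13 1, .store 14 1]

/-- Keep the current edge if fewer than `R[4]` edges are kept at either endpoint; otherwise
turn both endpoints into core vertices. -/
def selectBody : Prog :=
  .seq (fetch 7) (.ite 15 4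
    (.ite 16 4 (block [.add 15 15 1, .add 16 16 1, .store 13 15, .store 14 16]) (setOnes 8))
    (setOnes 8))

/-- Mark both endpoints of the current edge if one of them is a core vertex. -/
def markBody : Prog :=
  .seq (fetch 8) (.ite 0 15 (setOnes 9) (.ite 0 16 (setOnes 9) .skip))

/-- Give the current vertex the next number if it is marked. -/
def numberBody : Prog :=
  .seq (block [.add 13 9 17, .load 15 13])
    (.seq (.ite 0 15 (block [.add 14 10 17, .store 14 18, .add 18 18 1]) .skip)
      (block [.add 17 17 1]))

/-- Execute `p` if both endpoints of the current edge are marked. -/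
def ifMarked (p : Prog) : Prog :=
  .seq (fetch 9) (.ite 0 15 (.ite 0 16 p .skip) .skip)

/-- Set up the registers. -/
def setup : Prog :=
  block [.const 1 1, .load 2 0, .load 3 1, .const 13 2, .load 4 13, .sub 4 4 1, .const 7 4,
    .add 7 7 3, .add 7 7 3, .add 8 7 2, .add 9 8 2, .add 10 9 2]

/-- Write the parameters of the kernel. -/
def header : Prog :=
  .seq (block [.write 18, .write 19, .const 13 2, .load 13 13, .write 13, .const 14 3,
    .load 14 14]) (.ite 14 19 (block [.write 14]) (block [.write 19]))

/-- Write the new numbers of the endpoints of the current edge. -/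
def writeEdge : Prog :=
  .seq (fetch 10) (block [.write 15, .write 16])

/-- The kernelization. -/
def kernelize : Prog :=
  .seq setup <| .seq (forEdges selectBody) <| .seq (forEdges markBody) <|
    .seq (.loop 17 2 numberBody) <| .seq (forEdges (ifMarked (block [.add 19 19 1]))) <|
    .seq header (forEdges (ifMarked writeEdge))

end Programs

/-! ### The combinatorial meaning of the arrays -/

section Verification

variable {n : ℕ} {edges : List (Fin n × Fin n)} {c k w : ℕ}

open Classical in
/-- The indicator function of a predicate. -/
noncomputable def ind (P : Fin n → Prop) (v : Fin n) : ℕ := if P v then 1 else 0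

lemma ind_pos {P : Fin n → Prop} {v : Fin n} : 0 < ind P v ↔ P v := by
  unfold ind; split_ifs with h <;> simp [h]

/-- `v` is incident with an edge of `l` that is not in `K`. -/
def IsCore (K : Finset (Sym2 (Fin n))) (l : List (Fin n × Fin n)) (v : Fin n) : Prop :=
  ∃ p ∈ l, s(p.1, p.2) ∉ K ∧ (v = p.1 ∨ v = p.2)

/-- `v` is incident with an edge of `l` that has an endpoint in `P`. -/
def IsNear (P : Fin n → Prop) (l : List (Fin n × Fin n)) (v : Fin n) : Prop :=
  ∃ p ∈ l, (P p.1 ∨ P p.2) ∧ (v = p.1 ∨ v = p.2)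

/-- `K` is a set of edges of `l` that is maximal under the condition that it induces degrees
at most `t`. -/
structure IsSelection (K : Finset (Sym2 (Fin n))) (t : ℕ) (l : List (Fin n × Fin n)) : Prop where
  mem : ∀ e ∈ K, ∃ p ∈ l, e = s(p.1, p.2)
  deg_le : ∀ v, #{e ∈ K | v ∈ e} ≤ t
  full : ∀ p ∈ l, s(p.1, p.2) ∉ K → #{e ∈ K | p.1 ∈ e} = t ∨ #{e ∈ K | p.2 ∈ e} = t

/-- The state during the selection. -/
def SelectInv (m t : ℕ) (l : List (Fin n × Fin n)) (s : State) : Prop :=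
  s.out = [] ∧ s.reg 17 = 0 ∧ s.reg 18 = 0 ∧ s.reg 19 = 0 ∧
  ∃ K : Finset (Sym2 (Fin n)), IsSelection K t l ∧
    Holds n m 0 (fun v => #{e ∈ K | v ∈ e}) s ∧ Holds n m 1 (ind (IsCore K l)) s ∧
    Holds n m 2 (fun _ => 0) s

/-- Both endpoints of the new edge are unsaturated. So saturated endpoints of earlier rejected edges
stay saturated, and no earlier rejected edge coincides with the new one. -/
lemma IsSelection.insert {K : Finset (Sym2 (Fin n))} {t : ℕ} {l : List (Fin n × Fin n)}
    (h : IsSelection K t l) {p : Fin n × Fin n} (h1 : #{e ∈ K | p.1 ∈ e} < t)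
    (h2 : #{e ∈ K | p.2 ∈ e} < t) (hp : s(p.1, p.2) ∉ K) :
    IsSelection (insert s(p.1, p.2) K) t (l ++ [p]) ∧
      (∀ v, #{e ∈ Insert.insert s(p.1, p.2) K | v ∈ e} =
        #{e ∈ K | v ∈ e} + if v = p.1 ∨ v = p.2 then 1 else 0) ∧
      ∀ v, IsCore (Insert.insert s(p.1, p.2) K) (l ++ [p]) v ↔ IsCore K l v := by
  have hcount : ∀ v, #{e ∈ Insert.insert s(p.1, p.2) K | v ∈ e} =
        #{e ∈ K | v ∈ e} + if v = p.1 ∨ v = p.2 then 1 else 0 := by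
    intro v
    rw [filter_insert]
    simp only [Sym2.mem_iff]
    split_ifs
    · rw [card_insert_of_notMem (by simp [hp])]
    · rfl
  refine ⟨⟨?_, ?_, ?_⟩, hcount, ?_⟩
  · intro e he
    rcases mem_insert.1 he with rfl | he
    · exact ⟨p, by simp, rfl⟩
    · obtain ⟨q, hq, rfl⟩ := h.mem e he
      exact ⟨q, by simp [hq], rfl⟩
  · intro v
    rw [hcount]
    split_ifs with hv
    · rcases hv with rfl | rfl <;> omega
    · exact h.deg_le v
  · intro q hq hqK
    rw [mem_insert, not_or] at hqK
    have hql : q ∈ l := by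
      rcases List.mem_append.1 hq with hq | hq
      · exact hq
      · obtain rfl : q = p := by simpa using hq
        exact absurd rfl hqK.1
    have aux : ∀ v, #{e ∈ K | v ∈ e} = t →
        #{e ∈ Insert.insert s(p.1, p.2) K | v ∈ e} = t := by
      intro v hv
      have : ¬ (v = p.1 ∨ v = p.2) := by rintro (rfl | rfl) <;> omega
      rw [hcount, if_neg this, hv, add_zero]
    exact (h.full q hql hqK.2).imp (aux _) (aux _)
  · intro v
    constructor
    · rintro ⟨q, hq, hqK, hv⟩
      rw [mem_insert, not_or] at hqK
      rcases List.mem_append.1 hq with hq | hq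
      · exact ⟨q, hq, hqK.2, hv⟩
      · obtain rfl : q = p := by simpa using hq
        exact absurd rfl hqK.1
    · rintro ⟨q, hq, hqK, hv⟩
      refine ⟨q, by simp [hq], ?_, hv⟩
      rw [mem_insert, not_or]
      refine ⟨fun heq => ?_, hqK⟩
      have aux : ∀ v, #{e ∈ K | v ∈ e} = t → v ∉ s(p.1, p.2) := by
        intro v hv hmem
        rcases Sym2.mem_iff.1 hmem with rfl | rfl <;> omega
      rcases h.full q hq hqK with h' | h'
      · exact aux _ h' (by rw [← heq]; simp)
      · exact aux _ h' (by rw [← heq]; simp)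

lemma IsSelection.append {K : Finset (Sym2 (Fin n))} {t : ℕ} {l : List (Fin n × Fin n)}
    (h : IsSelection K t l) {p : Fin n × Fin n}
    (h1 : ¬ (#{e ∈ K | p.1 ∈ e} < t ∧ #{e ∈ K | p.2 ∈ e} < t)) :
    IsSelection K t (l ++ [p]) where
  mem e he := by
    obtain ⟨q, hq, rfl⟩ := h.mem e he
    exact ⟨q, by simp [hq], rfl⟩
  deg_le := h.deg_le
  full q hq hqK := by
    rcases List.mem_append.1 hq with hq | hq
    · exact h.full q hq hqK
    · obtain rfl : q = p := by simpa using hq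
      have := h.deg_le q.1
      have := h.deg_le q.2
      omega

lemma isCore_append {K : Finset (Sym2 (Fin n))} {l : List (Fin n × Fin n)} {p : Fin n × Fin n}
    (hp : s(p.1, p.2) ∉ K) (v : Fin n) :
    IsCore K (l ++ [p]) v ↔ IsCore K l v ∨ v = p.1 ∨ v = p.2 := by
  simp only [IsCore, List.mem_append, List.mem_singleton, or_and_right, exists_or]
  simp [hp]

lemma isNear_append {P : Fin n → Prop} {l : List (Fin n × Fin n)} {p : Fin n × Fin n}
    (v : Fin n) :
    IsNear P (l ++ [p]) v ↔ IsNear P l v ∨ (P p.1 ∨ P p.2) ∧ (v = p.1 ∨ v = p.2) := by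
  simp only [IsNear, List.mem_append, List.mem_singleton, or_and_right, exists_or]
  simp

lemma ind_congr {P Q : Fin n → Prop} (h : ∀ v, P v ↔ Q v) : ind P = ind Q := by
  rw [show P = Q from funext fun v => propext (h v)]

lemma ind_of_or {P Q R : Fin n → Prop} (h : ∀ v, P v ↔ Q v ∨ R v) [DecidablePred R] (v : Fin n) :
    ind P v = if R v then 1 else ind Q v := by
  have := h v
  unfold ind
  split_ifs <;> grind

end Verification

/-! ### Selecting edges and marking the kernel vertices -/

section Loops

variable {n : ℕ} {edges : List (Fin n × Fin n)} {c k w : ℕ}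

/-- The two states differ only in the memory and in the scratch registers 13 to 16. -/
structure SameRegs (s s' : State) : Prop where
  reg : ∀ r, (r < 13 ∨ 16 < r) → s'.reg r = s.reg r
  out : s'.out = s.out

lemma Ready.of_sameRegs {s s' : State} (h : Ready edges c k s) (hs : SameRegs s s')
    (hmem : ∀ a < 4 + 2 * edges.length, s'.mem a = s.mem a) : Ready edges c k s' :=
  h.congr (fun r hr _ => hs.reg r (by omega)) hmem

lemma Holds.of_mem_eq {m i : ℕ} {f : Fin n → ℕ} {s s' : State} (h : Holds n m i f s)
    (hm : s'.mem = s.mem) : Holds n m i f s' := fun v => by rw [hm, h v]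

lemma ne_arr_add {m i : ℕ} {v : Fin n} {a : ℕ} (ha : a < 4 + 2 * m) : a ≠ arr n m i + v :=
  ((le_arr_add n m i v).trans_lt' ha).ne

lemma wp_fetch (hw : 4 + 2 * edges.length + 4 * n ≤ w) {s : State} {p : Fin n × Fin n}
    (h11 : s.reg 11 = p.1) (h12 : s.reg 12 = p.2) {b i : ℕ} (hb : b < 13) (hi : i ≤ 3)
    (hbi : s.reg b = arr n edges.length i) {f : Fin n → ℕ} (hf : Holds n edges.length i f s)
    {Q : State → Prop}
    (hQ : ∀ s', SameRegs s s' → s'.mem = s.mem → s'.reg 13 = arr n edges.length i + p.1 →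
      s'.reg 14 = arr n edges.length i + p.2 → s'.reg 15 = f p.1 → s'.reg 16 = f p.2 → Q s') :
    (fetch b).wp w Q s := by
  have a := arr_add_le (n := n) (m := edges.length) hi
  have e1 := hf p.1
  have e2 := hf p.2
  simp only [fetch, wp_block_cons, wp_block_nil, Instr.wp, reg_setReg, mem_setReg]
  norm_num
  simp only [show b ≠ 13 by omega, if_false, h11, h12, hbi]
  refine ⟨(a _).trans hw, (a _).trans hw, hQ _ ⟨?_, rfl⟩ rfl ?_ ?_ ?_ ?_⟩
  · intro r hr
    simp [show r ≠ 13 by omega, show r ≠ 14 by omega, show r ≠ 15 by omega,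
      show r ≠ 16 by omega]
  · simp
  · simp
  · simp [e1]
  · simp [e2]

lemma wp_setOnes (hw : 4 + 2 * edges.length + 4 * n ≤ w) {s : State} (hs : Ready edges c k s)
    {p : Fin n × Fin n} (h11 : s.reg 11 = p.1) (h12 : s.reg 12 = p.2) {b i : ℕ} (hb : b < 13)
    (hi : i ≤ 3) (hbi : s.reg b = arr n edges.length i) {Q : State → Prop}
    (hQ : ∀ s', SameRegs s s' → Ready edges c k s' →
      (∀ j ≠ i, ∀ f, Holds n edges.length j f s → Holds n edges.length j f s') →
      (∀ f, Holds n edges.length i f s →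
        Holds n edges.length i (fun v => if v = p.1 ∨ v = p.2 then 1 else f v) s') → Q s') :
    (setOnes b).wp w Q s := by
  have a := arr_add_le (n := n) (m := edges.length) hi
  simp only [setOnes, wp_block_cons, wp_block_nil, Instr.wp, reg_setReg, reg_setMem]
  norm_num
  simp only [show b ≠ 13 by omega, if_false, h11, h12, hbi, hs.one]
  have hsame : SameRegs s ((((s.setReg 13 (arr n edges.length i + p.1)).setReg 14
      (arr n edges.length i + p.2)).setMem (arr n edges.length i + p.1) 1).setMem
      (arr n edges.length i + p.2) 1) := by
    refine ⟨?_, rfl⟩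
    intro r hr
    simp [show r ≠ 13 by omega, show r ≠ 14 by omega]
  refine ⟨(a _).trans hw, (a _).trans hw, hQ _ hsame (hs.of_sameRegs hsame ?_) ?_ ?_⟩
  · intro a ha
    simp [ne_arr_add ha]
  · intro j hj f hf v
    simp [arr_add_eq_iff, hj, hf v]
  · intro f hf v
    simp only [mem_setMem, mem_setReg, arr_add_eq_iff, true_and, hf v]
    grind

lemma SelectInv.congr {m t : ℕ} {l : List (Fin n × Fin n)} {s s' : State}
    (h : SelectInv m t l s) (hm : s'.mem = s.mem) (ho : s'.out = s.out)
    (hr : ∀ r ≥ 17, s'.reg r = s.reg r) : SelectInv m t l s' := by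
  obtain ⟨h1, h2, h3, h4, K, hK, h5, h6, h7⟩ := h
  exact ⟨by rw [ho, h1], by rw [hr 17 (by omega), h2], by rw [hr 18 (by omega), h3],
    by rw [hr 19 (by omega), h4], K, hK, h5.of_mem_eq hm, h6.of_mem_eq hm, h7.of_mem_eq hm⟩

lemma run_select (hnd : (edges.map fun p => s(p.1, p.2)).Nodup)
    (hw : 4 + 2 * edges.length + 4 * n + c ≤ w) {s : State} (hs : Ready edges c k s)
    (h : SelectInv edges.length (c - 1) ([] : List (Fin n × Fin n)) s) :
    Run w (forEdges selectBody) (edges.length * (selectBody.cost + 6) + 3)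
      (fun s' => Ready edges c k s' ∧ SelectInv edges.length (c - 1) edges s') s := by
  refine run_forEdges (by omega) _ ?_ ?_ hs h
  · intro l s s' h hm ho hr
    exact h.congr hm ho fun r h => hr r (by omega)
  rintro l p hlp s hR ⟨hout, h17, h18, h19, K, hK, hcnt, hcore, hmark⟩ h11 h12
  -- The edge list has no repetitions, so the current edge has not been kept before.
  have hp : s(p.1, p.2) ∉ K := by
    intro hmem
    obtain ⟨q, hq, hqp⟩ := hK.mem _ hmem
    have := (hlp.sublist.map fun p => s(p.1, p.2)).nodup hnd
    rw [List.map_append, List.nodup_append] at this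
    exact this.2.2 _ (List.mem_map_of_mem hq) _ (by simp) hqp.symm
  refine wp_fetch (by omega) h11 h12 (by omega) (by omega) hR.cnt hcnt ?_
  intro s₁ hs₁ hm h13 h14 h15 h16
  have hR₁ := hR.of_sameRegs hs₁ fun a _ => by rw [hm]
  have hrej : ¬ (#{e ∈ K | p.1 ∈ e} < c - 1 ∧ #{e ∈ K | p.2 ∈ e} < c - 1) →
      (setOnes 8).wp w (fun s' => Ready edges c k s' ∧ s'.reg 6 = s.reg 6 ∧
        SelectInv edges.length (c - 1) (l ++ [p]) s') s₁ := by
    intro hfull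
    refine wp_setOnes (by omega) hR₁ ((hs₁.reg 11 (by omega)).trans h11)
      ((hs₁.reg 12 (by omega)).trans h12) (by omega) (by omega) hR₁.core ?_
    intro s' hs' hR' hj hi
    refine ⟨hR', by rw [hs'.reg 6 (by omega), hs₁.reg 6 (by omega)], by rw [hs'.out, hs₁.out, hout],
      by rw [hs'.reg 17 (by omega), hs₁.reg 17 (by omega), h17],
      by rw [hs'.reg 18 (by omega), hs₁.reg 18 (by omega), h18],
      by rw [hs'.reg 19 (by omega), hs₁.reg 19 (by omega), h19],
      K, hK.append hfull, hj 0 (by omega) _ (hcnt.of_mem_eq hm), ?_,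
      hj 2 (by omega) _ (hmark.of_mem_eq hm)⟩
    intro v
    rw [ind_of_or (R := fun v => v = p.1 ∨ v = p.2) (isCore_append hp)]
    exact hi _ (hcore.of_mem_eq hm) v
  simp only [Prog.wp]
  rw [h15, h16, hR₁.t]
  refine ⟨fun hlt => ⟨fun hlt' => ?_, fun hge => hrej (by omega)⟩, fun hge => hrej (by omega)⟩
  obtain ⟨hK', hcard, hcore'⟩ := hK.insert hlt hlt' hp
  simp only [wp_block_cons, wp_block_nil, Instr.wp, reg_setReg, reg_setMem]
  norm_num
  simp only [h13, h14, h15, h16, hR₁.one]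
  -- An incremented counter is at most `c - 1`; this is where the word bound has to cover `c`.
  refine ⟨by omega, by omega, ?_, hs₁.reg 6 (by omega), ?_⟩
  · refine hR₁.congr ?_ ?_
    · intro r hr h6
      simp [show r ≠ 15 by omega, show r ≠ 16 by omega]
    · intro a ha
      simp [ne_arr_add ha]
  · refine ⟨by simp [hs₁.out, hout], by simp [hs₁.reg, h17], by simp [hs₁.reg, h18],
      by simp [hs₁.reg, h19], _, hK', ?_, ?_, ?_⟩
    · intro v
      simp only [mem_setMem, mem_setReg, arr_add_eq_iff, true_and, hm, hcnt v, hcard v]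
      grind
    · intro v
      rw [ind_congr hcore']
      simp [arr_add_eq_iff, hm, hcore v]
    · intro v
      simp [arr_add_eq_iff, hm, hmark v]

/-- The state during the marking of the vertices that are near to `P`. -/
structure MarkInv (m : ℕ) (P : Fin n → Prop) (l : List (Fin n × Fin n)) (s : State) : Prop where
  out : s.out = []
  reg17 : s.reg 17 = 0
  reg18 : s.reg 18 = 0
  reg19 : s.reg 19 = 0
  core : Holds n m 1 (ind P) s
  mark : Holds n m 2 (ind (IsNear P l)) s

lemma run_mark (hw : 4 + 2 * edges.length + 4 * n ≤ w) {s : State} (hs : Ready edges c k s)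
    {P : Fin n → Prop} (h : MarkInv edges.length P [] s) :
    Run w (forEdges markBody) (edges.length * (markBody.cost + 6) + 3)
      (fun s' => Ready edges c k s' ∧ MarkInv edges.length P edges s') s := by
  refine run_forEdges (by omega) _ ?_ ?_ hs h
  · intro l s s' h hm ho hr
    exact ⟨by rw [ho, h.out], by rw [hr 17 (by omega), h.reg17], by rw [hr 18 (by omega), h.reg18],
      by rw [hr 19 (by omega), h.reg19], h.core.of_mem_eq hm, h.mark.of_mem_eq hm⟩
  intro l p hlp s hR hI h11 h12
  refine wp_fetch (by omega) h11 h12 (by omega) (by omega) hR.core hI.core ?_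
  intro s₁ hs₁ hm h13 h14 h15 h16
  have hR₁ := hR.of_sameRegs hs₁ fun a _ => by rw [hm]
  have hset : P p.1 ∨ P p.2 →
      (setOnes 9).wp w (fun s' => Ready edges c k s' ∧ s'.reg 6 = s.reg 6 ∧
        MarkInv edges.length P (l ++ [p]) s') s₁ := by
    intro hP
    refine wp_setOnes (by omega) hR₁ ((hs₁.reg 11 (by omega)).trans h11)
      ((hs₁.reg 12 (by omega)).trans h12) (by omega) (by omega) hR₁.mark ?_
    intro s' hs' hR' hj hi
    refine ⟨hR', by rw [hs'.reg 6 (by omega), hs₁.reg 6 (by omega)],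
      by rw [hs'.out, hs₁.out, hI.out],
      by rw [hs'.reg 17 (by omega), hs₁.reg 17 (by omega), hI.reg17],
      by rw [hs'.reg 18 (by omega), hs₁.reg 18 (by omega), hI.reg18],
      by rw [hs'.reg 19 (by omega), hs₁.reg 19 (by omega), hI.reg19],
      hj 1 (by omega) _ (hI.core.of_mem_eq hm), ?_⟩
    intro v
    rw [ind_of_or (Q := IsNear P l) (R := fun v => v = p.1 ∨ v = p.2)
      (fun v => by rw [isNear_append]; tauto)]
    exact hi _ (hI.mark.of_mem_eq hm) v
  simp only [Prog.wp]
  rw [h15, h16, hR₁.zero, ind_pos, ind_pos]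
  refine ⟨fun h => hset (Or.inl h), fun h1 => ⟨fun h => hset (Or.inr h), fun h2 => ?_⟩⟩
  refine ⟨hR₁, hs₁.reg 6 (by omega), by rw [hs₁.out, hI.out],
    by rw [hs₁.reg 17 (by omega), hI.reg17], by rw [hs₁.reg 18 (by omega), hI.reg18],
    by rw [hs₁.reg 19 (by omega), hI.reg19], hI.core.of_mem_eq hm, ?_⟩
  rw [ind_congr (Q := IsNear P l) (fun v => by rw [isNear_append]; tauto)]
  exact hI.mark.of_mem_eq hm

end Loops

end RAM

namespace RAM

open Finset

/-! ### Numbering the marked vertices and writing the kernel -/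

section Numbering

variable {n : ℕ} {edges : List (Fin n × Fin n)} {c k w : ℕ}

open Classical in
/-- The number of vertices in `M` that are smaller than `i`. -/
noncomputable def idx (M : Fin n → Prop) (i : ℕ) : ℕ :=
  Nat.count (fun j => ∃ h : j < n, M ⟨j, h⟩) i

open Classical in
/-- The edges in the list with both endpoints in `M`. -/
noncomputable def inside (M : Fin n → Prop) (l : List (Fin n × Fin n)) : List (Fin n × Fin n) :=
  l.filter fun p => M p.1 ∧ M p.2

lemma idx_succ_of_pos {M : Fin n → Prop} {i : ℕ} (hi : i < n) (h : M ⟨i, hi⟩) :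
    idx M (i + 1) = idx M i + 1 := by
  rw [idx, Nat.count_succ, if_pos ⟨hi, h⟩]; rfl

lemma idx_succ_of_neg {M : Fin n → Prop} {i : ℕ} (hi : i < n) (h : ¬ M ⟨i, hi⟩) :
    idx M (i + 1) = idx M i := by
  rw [idx, Nat.count_succ, if_neg fun ⟨_, h'⟩ => h h']; rfl

lemma idx_le (M : Fin n → Prop) (i : ℕ) : idx M i ≤ i := by
  classical
  exact Nat.count_le _

lemma inside_append_of_pos {M : Fin n → Prop} {l : List (Fin n × Fin n)} {p : Fin n × Fin n}
    (h : M p.1 ∧ M p.2) : inside M (l ++ [p]) = inside M l ++ [p] := by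
  simp [inside, h]

lemma inside_append_of_neg {M : Fin n → Prop} {l : List (Fin n × Fin n)} {p : Fin n × Fin n}
    (h : ¬ (M p.1 ∧ M p.2)) : inside M (l ++ [p]) = inside M l := by
  simpa [inside] using h

/-- The state while the vertices in `M` that are smaller than `i` are numbered. -/
structure NumberInv (m : ℕ) (M : Fin n → Prop) (i : ℕ) (s : State) : Prop where
  out : s.out = []
  reg17 : s.reg 17 = i
  reg18 : s.reg 18 = idx M i
  reg19 : s.reg 19 = 0
  mark : Holds n m 2 (ind M) s
  ids : ∀ v : Fin n, (v : ℕ) < i → M v → s.mem (arr n m 3 + v) = idx M v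

lemma run_number (hw : 4 + 2 * edges.length + 4 * n ≤ w) {s : State} (hs : Ready edges c k s)
    {M : Fin n → Prop} (h : NumberInv edges.length M 0 s) :
    Run w (.loop 17 2 numberBody) (n * (numberBody.cost + 1) + 1)
      (fun s' => Ready edges c k s' ∧ NumberInv edges.length M n s') s := by
  refine Run.loop (fun i s => Ready edges c k s ∧ NumberInv edges.length M i s) ?_ ?_ ⟨hs, h⟩
  · rintro i hi s ⟨hR, hI⟩
    refine ⟨by rw [hI.reg17, hR.order]; exact hi, run_of_wp ?_⟩
    have a2 := arr_add_le (n := n) (m := edges.length) (i := 2) (by omega) ⟨i, hi⟩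
    have a3 := arr_add_le (n := n) (m := edges.length) (i := 3) (by omega) ⟨i, hi⟩
    have hle := idx_le M i
    simp only at a2 a3
    simp only [numberBody, Prog.wp, wp_block_cons, wp_block_nil, Instr.wp, reg_setReg, mem_setReg]
    norm_num
    have hmi := hI.mark ⟨i, hi⟩
    simp only at hmi
    simp only [hR.mark, hI.reg17, hR.zero, hR.id, hR.one, hI.reg18, hmi, ← not_lt, ind_pos]
    refine ⟨by omega, fun hM => ⟨by omega, by omega, by omega, ?_, ?_, ?_, ?_, ?_, ?_, ?_⟩,
      fun hM => ⟨by omega, ?_, ?_, ?_, ?_, ?_, ?_, ?_⟩⟩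
    · refine hR.congr ?_ ?_
      · intro r hr h6
        simp [show r ≠ 13 by omega, show r ≠ 14 by omega, show r ≠ 15 by omega,
          show r ≠ 17 by omega, show r ≠ 18 by omega]
      · intro a ha
        simp only [mem_setReg, mem_setMem, ite_eq_right_iff]
        intro h
        exact absurd h (ne_arr_add (n := n) (v := ⟨i, hi⟩) ha)
    · simp [hI.out]
    · simp
    · simp [idx_succ_of_pos hi hM]
    · simp [hI.reg19]
    · intro v
      have : arr n edges.length 2 + (v : ℕ) ≠ arr n edges.length 3 + i := by
        intro h
        have := (arr_add_eq_iff (v := ⟨i, hi⟩)).1 h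
        omega
      simp [this, hI.mark v]
    · intro v hv hMv
      have : arr n edges.length 3 + (v : ℕ) = arr n edges.length 3 + i ↔ (v : ℕ) = i := by omega
      simp only [mem_setReg, mem_setMem, this]
      split_ifs with h
      · rw [h]
      · exact hI.ids v (by omega) hMv
    · refine hR.congr ?_ ?_
      · intro r hr h6
        simp [show r ≠ 13 by omega, show r ≠ 15 by omega, show r ≠ 17 by omega]
      · intro a ha
        rfl
    · simp [hI.out]
    · simp
    · simp [idx_succ_of_neg hi hM, hI.reg18]
    · simp [hI.reg19]
    · intro v
      simp [hI.mark v]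
    · intro v hv hMv
      refine hI.ids v ?_ hMv
      by_contra h
      exact hM ((Fin.ext (by simp only; omega) : v = ⟨i, hi⟩) ▸ hMv)
  · rintro s ⟨hR, hI⟩
    rw [hI.reg17, hR.order]
    exact lt_irrefl n

/-- The state after the numbering of the vertices in `M`. -/
structure Numbered (m : ℕ) (M : Fin n → Prop) (s : State) : Prop where
  reg18 : s.reg 18 = idx M n
  mark : Holds n m 2 (ind M) s
  ids : ∀ v : Fin n, M v → s.mem (arr n m 3 + v) = idx M v

lemma Numbered.congr {m : ℕ} {M : Fin n → Prop} {s s' : State} (h : Numbered m M s)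
    (hm : s'.mem = s.mem) (hr : s'.reg 18 = s.reg 18) : Numbered m M s' where
  reg18 := by rw [hr, h.reg18]
  mark := h.mark.of_mem_eq hm
  ids v hv := by rw [hm, h.ids v hv]

lemma wp_ifMarked (hw : 4 + 2 * edges.length + 4 * n ≤ w) {s : State} (hR : Ready edges c k s)
    {M : Fin n → Prop} (hM : Holds n edges.length 2 (ind M) s) {p : Fin n × Fin n}
    (h11 : s.reg 11 = p.1) (h12 : s.reg 12 = p.2) {q : Prog} {Q : State → Prop}
    (hpos : M p.1 ∧ M p.2 → ∀ s', SameRegs s s' → s'.mem = s.mem → q.wp w Q s')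
    (hneg : ¬ (M p.1 ∧ M p.2) → ∀ s', SameRegs s s' → s'.mem = s.mem → Q s') :
    (ifMarked q).wp w Q s := by
  refine wp_fetch (by omega) h11 h12 (by omega) (by omega) hR.mark hM ?_
  intro s₁ hs₁ hm _ _ h15 h16
  have hR₁ := hR.of_sameRegs hs₁ fun a _ => by rw [hm]
  simp only [Prog.wp]
  rw [h15, h16, hR₁.zero, ind_pos, ind_pos]
  refine ⟨fun h1 => ⟨fun h2 => hpos ⟨h1, h2⟩ s₁ hs₁ hm, fun h2 => hneg (fun h => h2 h.2) s₁ hs₁ hm⟩,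
    fun h1 => hneg (fun h => h1 h.1) s₁ hs₁ hm⟩

lemma run_count (hw : 4 + 2 * edges.length + 4 * n ≤ w) {s : State} (hs : Ready edges c k s)
    {M : Fin n → Prop} (hn : Numbered edges.length M s) (hout : s.out = []) (h19 : s.reg 19 = 0) :
    Run w (forEdges (ifMarked (block [.add 19 19 1])))
      (edges.length * ((ifMarked (block [.add 19 19 1])).cost + 6) + 3)
      (fun s' => Ready edges c k s' ∧ Numbered edges.length M s' ∧ s'.out = [] ∧
        s'.reg 19 = (inside M edges).length) s := by
  refine run_forEdges (by omega) (fun l s' => Numbered edges.length M s' ∧ s'.out = [] ∧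
    s'.reg 19 = (inside M l).length) ?_ ?_ hs ⟨hn, hout, by simp [h19, inside]⟩
  · rintro l s s' ⟨h1, h2, h3⟩ hm ho hr
    exact ⟨h1.congr hm (hr 18 (by omega)), by rw [ho, h2], by rw [hr 19 (by omega), h3]⟩
  rintro l p hlp s hR ⟨hN, ho, h19⟩ h11 h12
  refine wp_ifMarked hw hR hN.mark h11 h12 ?_ ?_
  · intro hM s₁ hs₁ hm
    have hR₁ := hR.of_sameRegs hs₁ fun a _ => by rw [hm]
    have hlen : (inside M l).length + 1 ≤ edges.length := by
      have h1 := List.length_filter_le (fun p => open Classical in decide (M p.1 ∧ M p.2)) l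
      have h2 := hlp.length_le
      rw [List.length_append, List.length_singleton] at h2
      exact (Nat.succ_le_succ h1).trans h2
    simp only [wp_block_cons, wp_block_nil, Instr.wp]
    rw [hs₁.reg 19 (by omega), hR₁.one, h19]
    refine ⟨by omega, hR₁.congr ?_ fun _ _ => rfl, ?_, ?_, ?_, ?_⟩
    · intro r hr _
      simp [show r ≠ 19 by omega]
    · simp [hs₁.reg]
    · exact hN.congr (by simp [hm]) (by simp [hs₁.reg])
    · simp [hs₁.out, ho]
    · simp [inside_append_of_pos hM]
  · intro hM s₁ hs₁ hm
    refine ⟨hR.of_sameRegs hs₁ fun a _ => by rw [hm], hs₁.reg 6 (by omega),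
      hN.congr hm (hs₁.reg 18 (by omega)), by rw [hs₁.out, ho], ?_⟩
    rw [hs₁.reg 19 (by omega), h19, inside_append_of_neg hM]

lemma run_write (hw : 4 + 2 * edges.length + 4 * n ≤ w) {s : State} (hs : Ready edges c k s)
    {M : Fin n → Prop} (hn : Numbered edges.length M s) {o : List ℕ} (hout : s.out = o) :
    Run w (forEdges (ifMarked writeEdge)) (edges.length * ((ifMarked writeEdge).cost + 6) + 3)
      (fun s' => Ready edges c k s' ∧ Numbered edges.length M s' ∧
        s'.out = o ++ (inside M edges).flatMap fun p => [idx M p.1, idx M p.2]) s := by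
  refine run_forEdges (by omega) (fun l s' => Numbered edges.length M s' ∧
    s'.out = o ++ (inside M l).flatMap fun p => [idx M p.1, idx M p.2]) ?_ ?_ hs
    ⟨hn, by simp [hout, inside]⟩
  · rintro l s s' ⟨h1, h2⟩ hm ho hr
    exact ⟨h1.congr hm (hr 18 (by omega)), by rw [ho, h2]⟩
  rintro l p hlp s hR ⟨hN, ho⟩ h11 h12
  refine wp_ifMarked hw hR hN.mark h11 h12 ?_ ?_
  · intro hM s₁ hs₁ hm
    have hR₁ := hR.of_sameRegs hs₁ fun a _ => by rw [hm]
    -- Array 3 is specified only at marked vertices, so its actual contents serve as `f`; both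
    -- endpoints are marked here.
    refine wp_fetch (i := 3) (f := fun v => s₁.mem (arr n edges.length 3 + v)) (by omega)
      ((hs₁.reg 11 (by omega)).trans h11) ((hs₁.reg 12 (by omega)).trans h12) (by omega) (by omega)
      hR₁.id (fun v => rfl) ?_
    intro s₂ hs₂ hm₂ _ _ h15 h16
    have hR₂ := hR₁.of_sameRegs hs₂ fun a _ => by rw [hm₂]
    rw [hm, hN.ids _ hM.1] at h15
    rw [hm, hN.ids _ hM.2] at h16
    simp only [wp_block_cons, wp_block_nil, Instr.wp, reg_emit, h15, h16]
    refine ⟨hR₂.congr (fun _ _ _ => rfl) fun _ _ => rfl, ?_, ?_, ?_⟩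
    · rw [hs₂.reg 6 (by omega), hs₁.reg 6 (by omega)]
    · exact hN.congr (by simp [hm₂, hm])
        (by rw [reg_emit, reg_emit, hs₂.reg 18 (by omega), hs₁.reg 18 (by omega)])
    · simp [hs₂.out, hs₁.out, ho, inside_append_of_pos hM]
  · intro hM s₁ hs₁ hm
    refine ⟨hR.of_sameRegs hs₁ fun a _ => by rw [hm], hs₁.reg 6 (by omega),
      hN.congr hm (hs₁.reg 18 (by omega)), ?_⟩
    rw [hs₁.out, ho, inside_append_of_neg hM]

lemma run_header (hw : 3 ≤ w) {s : State} (hs : Ready edges c k s) {M : Fin n → Prop}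
    (hn : Numbered edges.length M s) (hout : s.out = []) {m' : ℕ} (h19 : s.reg 19 = m') :
    Run w header header.cost (fun s' => Ready edges c k s' ∧ Numbered edges.length M s' ∧
      s'.out = [idx M n, m', c, min k m']) s := by
  refine run_of_wp ?_
  simp only [header, Prog.wp, wp_block_cons, wp_block_nil, Instr.wp, reg_setReg, mem_setReg,
    reg_emit, mem_emit]
  norm_num
  simp only [hs.c, hs.k, h19, hn.reg18]
  refine ⟨by omega, hw, fun h => ⟨?_, ?_, ?_⟩, fun h => ⟨?_, ?_, ?_⟩⟩
  · refine hs.congr ?_ fun _ _ => rfl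
    intro r hr _
    simp [show r ≠ 13 by omega, show r ≠ 14 by omega]
  · exact hn.congr rfl (by simp)
  · simp [hout, h.le]
  · refine hs.congr ?_ fun _ _ => rfl
    intro r hr _
    simp [show r ≠ 13 by omega, show r ≠ 14 by omega]
  · exact hn.congr rfl (by simp)
  · simp [hout, h]

end Numbering

/-! ### Setup and composition of the phases -/

section Main

variable {n : ℕ} {edges : List (Fin n × Fin n)} {c k w : ℕ}

lemma getD_flatMap_pair (l : List (Fin n × Fin n)) :
    (∀ i (h : i < l.length),
      (l.flatMap fun p => [(p.1 : ℕ), (p.2 : ℕ)]).getD (2 * i) 0 = l[i].1 ∧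
      (l.flatMap fun p => [(p.1 : ℕ), (p.2 : ℕ)]).getD (2 * i + 1) 0 = l[i].2) ∧
    ∀ a, 2 * l.length ≤ a → (l.flatMap fun p => [(p.1 : ℕ), (p.2 : ℕ)]).getD a 0 = 0 := by
  induction l with
  | nil => simp
  | cons p l ih =>
    refine ⟨fun i h => ?_, fun a ha => ?_⟩
    · cases i with
      | zero => simp
      | succ i =>
        have := ih.1 i (by simpa using h)
        simpa [Nat.mul_succ] using this
    · obtain ⟨a, rfl⟩ : ∃ b, a = b + 2 := ⟨a - 2, by simp at ha; omega⟩
      have := ih.2 a (by simp at ha; omega)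
      simpa using this

lemma run_setup (hw : 4 + 2 * edges.length + 4 * n + c ≤ w) :
    Run w setup setup.cost
      (fun s => Ready edges c k s ∧
        SelectInv edges.length (c - 1) ([] : List (Fin n × Fin n)) s)
      (init (ECS.encode edges c k)) := by
  refine run_of_wp ?_
  have hn : (init (ECS.encode edges c k)).mem 0 = n := rfl
  have hm : (init (ECS.encode edges c k)).mem 1 = edges.length := rfl
  have hc : (init (ECS.encode edges c k)).mem 2 = c := rfl
  have hk : (init (ECS.encode edges c k)).mem 3 = k := rfl
  have hmem : ∀ a, (init (ECS.encode edges c k)).mem (4 + a) =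
      (edges.flatMap fun p => [(p.1 : ℕ), (p.2 : ℕ)]).getD a 0 := by
    intro a
    rw [add_comm]; rfl
  have hreg : ∀ r, (init (ECS.encode edges c k)).reg r = 0 := fun r => rfl
  have hout : (init (ECS.encode edges c k)).out = [] := rfl
  obtain ⟨hget, hzero⟩ := getD_flatMap_pair edges
  -- The arrays stand behind the input, where memory is initially zero, so they need no
  -- initialization.
  have harr : ∀ i (v : Fin n),
      (init (ECS.encode edges c k)).mem (arr n edges.length i + v) = 0 := by
    intro i v
    rw [arr, add_assoc, add_assoc, hmem]
    exact hzero _ (by omega)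
  simp only [setup, wp_block_cons, wp_block_nil, Instr.wp, reg_setReg, mem_setReg]
  norm_num
  simp only [hreg, hn, hm, hc]
  refine ⟨by omega, by omega, by omega, by omega, by omega, by omega, by omega, by omega, ?_, ?_⟩
  · constructor
    · simp [hreg]
    · simp
    · simp
    · simp
    · simp [arr]; omega
    · simp [arr]; omega
    · simp [arr]; omega
    · simp [arr]; omega
    · exact hc
    · exact hk
    · intro i hi
      simp only [mem_setReg]
      rw [hmem, (hget i hi).1]
    · intro i hi
      simp only [mem_setReg]
      rw [show 5 + 2 * i = 4 + (2 * i + 1) by omega, hmem, (hget i hi).2]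
  · refine ⟨hout, by simp [hreg], by simp [hreg], by simp [hreg], ∅, ⟨by simp, by simp, by simp⟩,
      ?_, ?_, ?_⟩
    · intro v; simp [harr]
    · intro v; simp [harr, ind, IsCore]
    · intro v; simp [harr]

/-- The result of the kernelization program. -/
theorem computes_kernelize (hnd : (edges.map fun p => s(p.1, p.2)).Nodup)
    (hw : 4 + 2 * edges.length + 4 * n + c ≤ w) :
    ∃ K : Finset (Sym2 (Fin n)), IsSelection K (c - 1) edges ∧
      ∀ M, M = IsNear (IsCore K edges) edges →
      Computes w (200 * (n + edges.length + 1)) kernelize (ECS.encode edges c k)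
        (idx M n :: (inside M edges).length :: c :: min k (inside M edges).length ::
          (inside M edges).flatMap fun p => [idx M p.1, idx M p.2]) := by
  obtain ⟨t₁, ht₁, s₁, hex₁, hR₁, hI₁⟩ := run_setup (k := k) hw
  obtain ⟨t₂, ht₂, s₂, hex₂, hR₂, hout, h17, h18, h19, K, hK, hcnt, hcore, hmark⟩ :=
    run_select hnd hw hR₁ hI₁
  refine ⟨K, hK, ?_⟩
  rintro M rfl
  set M := IsNear (IsCore K edges) edges with hM
  obtain ⟨t₃, ht₃, s₃, hex₃, hR₃, hI₃⟩ := run_mark (w := w) (P := IsCore K edges) (by omega) hR₂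
    ⟨hout, h17, h18, h19, hcore, fun v => by rw [hmark v]; simp [ind, IsNear]⟩
  obtain ⟨t₄, ht₄, s₄, hex₄, hR₄, hI₄⟩ := run_number (w := w) (M := M) (by omega) hR₃
    ⟨hI₃.out, hI₃.reg17, by rw [hI₃.reg18]; simp [idx], hI₃.reg19, hI₃.mark,
      fun v hv => absurd hv (Nat.not_lt_zero _)⟩
  obtain ⟨t₅, ht₅, s₅, hex₅, hR₅, hN₅, ho₅, h19₅⟩ := run_count (w := w) (M := M) (by omega) hR₄
    ⟨hI₄.reg18, hI₄.mark, fun v => hI₄.ids v v.2⟩ hI₄.out hI₄.reg19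
  obtain ⟨t₆, ht₆, s₆, hex₆, hR₆, hN₆, ho₆⟩ := run_header (w := w) (by omega) hR₅ hN₅ ho₅ h19₅
  obtain ⟨t₇, ht₇, s₇, hex₇, hR₇, hN₇, ho₇⟩ := run_write (w := w) (by omega) hR₆ hN₆ ho₆
  refine ⟨_, ?_, s₇, .seq hex₁ (.seq hex₂ (.seq hex₃ (.seq hex₄ (.seq hex₅ (.seq hex₆ hex₇))))), ?_⟩
  -- The phases add up to at most `92 m + 12 n + 39` steps for `m` edges.
  · have e1 : setup.cost = 13 := rfl
    have e2 : selectBody.cost = 22 := rfl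
    have e3 : markBody.cost = 18 := rfl
    have e4 : numberBody.cost = 11 := rfl
    have e5 : (ifMarked (block [.add 19 19 1])).cost = 11 := rfl
    have e6 : header.cost = 13 := rfl
    have e7 : (ifMarked writeEdge).cost = 17 := rfl
    rw [e1] at ht₁
    rw [e2] at ht₂
    rw [e3] at ht₃
    rw [e4] at ht₄
    rw [e5] at ht₅
    rw [e6] at ht₆
    rw [e7] at ht₇
    omega
  · rw [ho₇]; rfl

end Main

end RAM

/-! ### From the program output back to graphs -/

namespace ECS

open RAM Finset

lemma IsEdgeList.coe_toFinset {n : ℕ} {G : SimpleGraph (Fin n)} {l : List (Fin n × Fin n)}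
    (h : IsEdgeList G l) :
    (((l.map fun p => s(p.1, p.2)).toFinset : Finset (Sym2 (Fin n))) : Set (Sym2 (Fin n))) =
      G.edgeSet := by
  ext e
  rw [mem_coe, List.mem_toFinset, h.2]

lemma IsEdgeList.ncard_edgeSet {n : ℕ} {G : SimpleGraph (Fin n)} {l : List (Fin n × Fin n)}
    (h : IsEdgeList G l) : G.edgeSet.ncard = l.length := by
  rw [← h.coe_toFinset, Set.ncard_coe_finset, List.toFinset_card_of_nodup h.1, List.length_map]

/-- The numbering of the vertices in `M` is a bijection. -/
lemma exists_equiv_idx {n : ℕ} (M : Fin n → Prop) :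
    ∃ e : {v // M v} ≃ Fin (idx M n), ∀ v, (e v : ℕ) = idx M v.1 := by
  classical
  let q : ℕ → Prop := fun j => ∃ h : j < n, M ⟨j, h⟩
  have hq : ∀ v : Fin n, q v ↔ M v := fun v => ⟨fun ⟨_, h⟩ => h, fun h => ⟨v.2, h⟩⟩
  have hidx : ∀ i, idx M i = Nat.count q i := fun i => by unfold idx; congr
  have hlt : ∀ v : {v // M v}, idx M v.1 < idx M n := by
    intro v
    rw [hidx, hidx]
    exact Nat.count_strict_mono ((hq v.1).2 v.2) v.1.2
  let φ : {v // M v} → Fin (idx M n) := fun v => ⟨idx M v.1, hlt v⟩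
  have hbij : Function.Bijective φ := by
    constructor
    · intro u v h
      have h' : idx M u.1 = idx M v.1 := congrArg Fin.val h
      rw [hidx, hidx] at h'
      exact Subtype.ext (Fin.ext (Nat.count_injective ((hq _).2 u.2) ((hq _).2 v.2) h'))
    · intro j
      have hj : (j : ℕ) < Nat.count q n := by rw [← hidx]; exact j.2
      have hlt : Nat.nth q j < n := Nat.nth_lt_of_lt_count hj
      have hcard : ∀ hf : (Set.ofPred q).Finite, (j : ℕ) < #hf.toFinset := fun hf =>
        hj.trans_le (Nat.count_le_card hf n)
      have hmem : q (Nat.nth q j) := Nat.nth_mem _ hcard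
      -- The preimage of `j` is the marked vertex with exactly `j` marked vertices before it.
      refine ⟨⟨⟨Nat.nth q j, hlt⟩, (hq ⟨_, hlt⟩).1 hmem⟩, Fin.ext ?_⟩
      show idx M (Nat.nth q j) = j
      rw [hidx, Nat.count_nth hcard]
  exact ⟨Equiv.ofBijective φ hbij, fun v => rfl⟩

/-- Relabeling the edges of an induced subgraph yields an edge list. -/
lemma exists_isEdgeList_comap {n n' : ℕ} {G : SimpleGraph (Fin n)} {l : List (Fin n × Fin n)}
    (h : IsEdgeList G l) (M : Fin n → Prop) (f : Fin n' ↪ Fin n)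
    (hf : ∀ v, M v ↔ v ∈ Set.range f) :
    ∃ l' : List (Fin n' × Fin n'), IsEdgeList (G.comap f) l' ∧
      l'.map (Prod.map f f) = inside M l := by
  obtain ⟨l', hl'⟩ : inside M l ∈ Set.range (List.map (Prod.map f f)) := by
    rw [Set.range_list_map]
    intro p hp
    simp only [inside, List.mem_filter, decide_eq_true_eq] at hp
    obtain ⟨x, hx⟩ := (hf _).1 hp.2.1
    obtain ⟨y, hy⟩ := (hf _).1 hp.2.2
    exact ⟨(x, y), Prod.ext hx hy⟩
  have hinj : Function.Injective (Sym2.map f) := Sym2.map.injective f.injective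
  have hmap : (l'.map fun p => s(p.1, p.2)).map (Sym2.map f) =
      (inside M l).map fun p => s(p.1, p.2) := by
    rw [← hl', List.map_map, List.map_map]
    rfl
  refine ⟨l', ⟨?_, fun e => ?_⟩, hl'⟩
  · refine List.Nodup.of_map (Sym2.map f) ?_
    rw [hmap]
    exact (List.filter_sublist.map _).nodup h.1
  · rw [← List.mem_map_of_injective hinj, hmap]
    have h1 : e ∈ (G.comap f).edgeSet ↔ Sym2.map f e ∈ G.edgeSet := by
      induction e with
      | _ x y => rfl
    rw [h1, ← h.2]
    constructor
    · intro he
      exact (List.filter_sublist.map _).subset he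
    · intro he
      obtain ⟨p, hp, hpe⟩ := List.mem_map.1 he
      refine List.mem_map.2 ⟨p, ?_, hpe⟩
      have hM : ∀ v ∈ s(p.1, p.2), M v := by
        intro v hv
        rw [hpe] at hv
        obtain ⟨x, -, rfl⟩ := Sym2.mem_map.1 hv
        exact (hf _).2 ⟨x, rfl⟩
      simp only [inside, List.mem_filter, decide_eq_true_eq]
      exact ⟨hp, hM _ (by simp), hM _ (by simp)⟩

/-- The vertices that are marked by the program are the core vertices and their neighbors. -/
lemma isNear_isCore_iff {n : ℕ} {G : SimpleGraph (Fin n)} {l : List (Fin n × Fin n)}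
    (h : IsEdgeList G l) (K : Finset (Sym2 (Fin n))) (v : Fin n) :
    IsNear (IsCore K l) l v ↔
      v ∈ core ((l.map fun p => s(p.1, p.2)).toFinset \ K) ∪
        nbhd G (core ((l.map fun p => s(p.1, p.2)).toFinset \ K)) := by
  have hcore : ∀ v, IsCore K l v ↔ v ∈ core ((l.map fun p => s(p.1, p.2)).toFinset \ K) := by
    intro v
    constructor
    · rintro ⟨p, hp, hpK, hv⟩
      exact ⟨s(p.1, p.2), mem_sdiff.2 ⟨List.mem_toFinset.2 (List.mem_map_of_mem hp), hpK⟩,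
        by simpa using hv⟩
    · rintro ⟨e, he, hv⟩
      rw [mem_sdiff, List.mem_toFinset, List.mem_map] at he
      obtain ⟨⟨p, hp, rfl⟩, heK⟩ := he
      exact ⟨p, hp, heK, by simpa using hv⟩
  have hadj : ∀ p ∈ l, G.Adj p.1 p.2 := fun p hp =>
    (h.2 s(p.1, p.2)).1 (List.mem_map_of_mem hp)
  rw [Set.mem_union, ← hcore]
  simp only [nbhd, Set.mem_iUnion, exists_prop, ← hcore, SimpleGraph.mem_neighborSet]
  constructor
  · rintro ⟨p, hp, hc, hv⟩
    rcases hc with hc | hc <;> rcases hv with rfl | rfl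
    · exact Or.inl hc
    · exact Or.inr ⟨_, hc, hadj p hp⟩
    · exact Or.inr ⟨_, hc, (hadj p hp).symm⟩
    · exact Or.inl hc
  · rintro (hv | ⟨u, hu, huv⟩)
    -- A core vertex is marked through its own rejected edge.
    · obtain ⟨p, hp, hpK, hv'⟩ := hv
      refine ⟨p, hp, ?_, hv'⟩
      rcases hv' with rfl | rfl
      · exact Or.inl ⟨p, hp, hpK, Or.inl rfl⟩
      · exact Or.inl ⟨p, hp, hpK, Or.inl rfl⟩
    · obtain ⟨p, hp, hpe⟩ := List.mem_map.1 ((h.2 s(u, v)).2 huv)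
      refine ⟨p, hp, ?_⟩
      rcases Sym2.eq_iff.1 hpe with ⟨h1, h2⟩ | ⟨h1, h2⟩
      · rw [h1, h2]; exact ⟨Or.inl hu, Or.inr rfl⟩
      · rw [h1, h2]; exact ⟨Or.inr hu, Or.inl rfl⟩

end ECS

/-! ### The kernelization theorem -/

theorem theorem1 :
    ∃ (P : RAM.Prog) (T B A : ℕ),
      ∀ (n : ℕ) (G : SimpleGraph (Fin n)) (edges : List (Fin n × Fin n)) (c k : ℕ),
        ECS.IsEdgeList G edges → 1 ≤ c →
        ∃ (n' : ℕ) (G' : SimpleGraph (Fin n')) (edges' : List (Fin n' × Fin n')) (k' : ℕ),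
          ECS.IsEdgeList G' edges' ∧
          -- the program computes the instance `(G', c, k')` in `O(n + m)` steps
          -- on machine words of `O(log (n + m + c + k))` bits
          RAM.Computes (B * (n + G.edgeSet.ncard + c + k + 1)) (T * (n + G.edgeSet.ncard + 1)) P
            (ECS.encode edges c k) (ECS.encode edges' c k') ∧
          -- the two instances are equivalent
          (ECS.IsYes G c k ↔ ECS.IsYes G' c k') ∧
          -- the new instance is small
          n' ≤ 4 * ECS.xi G (c - 1) * c ∧
          G'.edgeSet.ncard ≤ A * (ECS.xi G (c - 1) * c ^ 2) ∧
          k' = min k G'.edgeSet.ncard ∧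
          -- its graph consists of the core vertices and their neighbors
          ∃ D : Finset (Sym2 (Fin n)), ECS.IsEdgeDeletionSet G (c - 1) D ∧
            Nonempty (G' ≃g G.induce (ECS.core D ∪ ECS.nbhd G (ECS.core D))) := by
  -- The word bound factor 10 covers `4 + 2 m + 4 n + c`; the time factor 200 is generous.
  refine ⟨RAM.kernelize, 200, 10, 4, fun n G edges c k hE hc => ?_⟩
  obtain ⟨t, rfl⟩ : ∃ t, c = t + 1 := ⟨c - 1, by omega⟩
  rw [Nat.add_sub_cancel]
  have hm := hE.ncard_edgeSet
  obtain ⟨K, hK, hcomp⟩ := RAM.computes_kernelize (k := k) (c := t + 1)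
    (w := 10 * (n + G.edgeSet.ncard + (t + 1) + k + 1)) hE.1 (by rw [hm]; omega)
  specialize hcomp _ rfl
  rw [Nat.add_sub_cancel] at hK
  set M := RAM.IsNear (RAM.IsCore K edges) edges with hM
  set E : Finset (Sym2 (Fin n)) := (edges.map fun p => s(p.1, p.2)).toFinset with hEdef
  have hEG : (E : Set (Sym2 (Fin n))) = G.edgeSet := hE.coe_toFinset
  have hKE : K ⊆ E := by
    intro e he
    obtain ⟨p, hp, rfl⟩ := hK.mem e he
    exact List.mem_toFinset.2 (List.mem_map_of_mem hp)
  have hmax : ∀ e ∈ E, e ∉ K → ∃ v ∈ e, (K.filter fun e => v ∈ e).card = t := by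
    intro e he heK
    obtain ⟨p, hp, rfl⟩ := List.mem_map.1 (List.mem_toFinset.1 he)
    rcases hK.full p hp heK with h | h
    · exact ⟨p.1, by simp, h⟩
    · exact ⟨p.2, by simp, h⟩
  have hD : ECS.IsEdgeDeletionSet G t (E \ K) := ECS.isEdgeDeletionSet_sdiff hEG hKE hK.deg_le
  have hcard : (E \ K).card ≤ 2 * ECS.xi G t :=
    ECS.card_sdiff_le_two_mul_xi hEG hKE hK.deg_le hmax
  have hmem := ECS.isNear_isCore_iff hE K
  obtain ⟨e, he⟩ := ECS.exists_equiv_idx M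
  let f : Fin (RAM.idx M n) ↪ Fin n :=
    ⟨fun j => (e.symm j).1, Subtype.val_injective.comp e.symm.injective⟩
  have hf : ∀ v, M v ↔ v ∈ Set.range f := by
    intro v
    constructor
    · intro hv
      exact ⟨e ⟨v, hv⟩, by simp [f]⟩
    · rintro ⟨j, rfl⟩
      exact (e.symm j).2
  have hrange : Set.range f = ECS.core (E \ K) ∪ ECS.nbhd G (ECS.core (E \ K)) := by
    ext v
    rw [← hf]
    exact hmem v
  -- The program's number for the vertex `f j` is `j`, so the written endpoints are those of
  -- `edges'`.
  have hidx : ∀ j, RAM.idx M (f j) = j := by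
    intro j
    refine (he (e.symm j)).symm.trans ?_
    rw [Equiv.apply_symm_apply]
  obtain ⟨edges', hE', hmap⟩ := ECS.exists_isEdgeList_comap hE M f hf
  have hm' := hE'.ncard_edgeSet
  have hlen : (RAM.inside M edges).length = edges'.length := by rw [← hmap, List.length_map]
  have hn' : RAM.idx M n ≤ 2 * (E \ K).card * (t + 1) := by
    refine le_trans (le_of_eq ?_) (ECS.ncard_core_union_nbhd_le hD)
    rw [← hrange, ← Set.image_univ, Set.ncard_image_of_injective _ f.injective, Set.ncard_univ,
      Nat.card_eq_fintype_card, Fintype.card_fin]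
  have hedge : (G.comap f).edgeSet.ncard ≤ (E \ K).card + RAM.idx M n * t := by
    have := ECS.ncard_edgeSet_le_of_embedding (SimpleGraph.Embedding.comap f G) hD
    rwa [Fintype.card_fin] at this
  refine ⟨RAM.idx M n, G.comap f, edges', min k (G.comap f).edgeSet.ncard, hE', ?_, ?_, ?_, ?_,
    rfl, E \ K, hD, ⟨?_⟩⟩
  · rw [hm] at hcomp ⊢
    convert hcomp using 1
    rw [ECS.encode, hlen, hm', ← hmap, List.flatMap_map]
    simp only [Prod.map, hidx]
  · refine ECS.isYes_iff_of_embedding (SimpleGraph.Embedding.comap f G) ?_ k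
    intro u hu w hw
    refine ECS.encard_neighborSet_lt_of_notMem hD ?_ hw
    rw [← hrange]
    exact hu
  · calc RAM.idx M n ≤ 2 * (E \ K).card * (t + 1) := hn'
      _ ≤ 2 * (2 * ECS.xi G t) * (t + 1) := by gcongr
      _ = 4 * ECS.xi G t * (t + 1) := by ring
  · calc (G.comap f).edgeSet.ncard ≤ (E \ K).card + RAM.idx M n * t := hedge
      _ ≤ 2 * ECS.xi G t + 2 * (2 * ECS.xi G t) * (t + 1) * t := by
        gcongr
        exact hn'.trans (by gcongr)
      -- The slack is `4 (t + 1)^2 - 4 t (t + 1) = 4 (t + 1) ≥ 2`, which absorbs the edges of `D`.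
      _ ≤ 4 * (ECS.xi G t * (t + 1) ^ 2) := by nlinarith [Nat.zero_le (ECS.xi G t * t)]
  · refine ⟨e.symm.trans (Equiv.subtypeEquivRight hmem), ?_⟩
    intro a b
    exact Iff.rfl
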